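/- Let $\mathcal A : f = \ell_1\cdots\ell_d = 0$ be an arrangement of $d$ distinct lines in $\mathbb P^2$ over $\mathbb C$, and let $\mathrm{mdr}(f)$ be the smallest integer $r\ge 0$ such that there is a nontrivial relation $a f_x + b f_y + c f_z = 0$ with $a,b,c\in\mathbb C[x,y,z]$ homogeneous of degree $r$. The intersection lattice $L(\mathcal A)$ is the set of all intersections of lines of $\mathcal A$ (taken as linear subspaces of $\mathbb C^3$, including $\mathbb C^3$ itself), ordered by reverse inclusion. For $2\le m\le d$, let $L(d,m)$ denote the intersection lattice of an arrangement of $d$ lines having one point of multiplicity $m$ and apart from that only double points. For $m_2\ge m_1\ge 3$, let $\hat L(m_1,m_2)$ denote the intersection lattice of an arrangement of $m_1+m_2-1$ lines having one point of multiplicity $m_1$ and one point of multiplicity $m_2$, exactly one line of the arrangement containing both, and apart from that only double points. If $\mathrm{mdr}(f)=2$, then $d\ge 4$ and at least one of the following holds: 1. $L(\mathcal A)\cong L(d,d-2)$; 2. $d\ge 5$ and $L(\mathcal A)\cong \hat L(3,d-2)$; 3. $\mathcal A$ is linearly equivalent to the monomial arrangement $\mathcal A(2,2,3) : (x^2-y^2)(x^2-z^2)(y^2-z^2)=0$,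 that is, an invertible linear change of the coordinates $x,y,z$ carries $f$ to a nonzero multiple of $(x^2-y^2)(x^2-z^2)(y^2-z^2)$. -/

import Mathlib

open MvPolynomial
open scoped LinearAlgebra.Projectivization

noncomputable section

/-- The linear form `a₀ x + a₁ y + a₂ z` in `ℂ[x, y, z]` with coefficient vector `a`. -/
def linForm (a : Fin 3 → ℂ) : MvPolynomial (Fin 3) ℂ :=
  ∑ j, C (a j) * X j

/-- `mdr f`, the minimal degree of a Jacobian syzygy: the least `r ≥ 0` such that there is a
nontrivial relation `a f_x + b f_y + c f_z = 0` with `a, b, c` homogeneous of degree `r`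
(the zero polynomial being homogeneous of every degree). For homogeneous `f` such relations
always exist, e.g. the Koszul ones or, if all partial derivatives vanish, the constant ones. -/
def mdr (f : MvPolynomial (Fin 3) ℂ) : ℕ :=
  sInf {r : ℕ | ∃ a : Fin 3 → MvPolynomial (Fin 3) ℂ,
    a ≠ 0 ∧ (∀ i, (a i).IsHomogeneous r) ∧ ∑ i, a i * pderiv i f = 0}

/-- An arrangement of `d` distinct lines in the complex projective plane: the `i`-th line is the
zero set of the linear form with coefficient vector `coeff i`. -/
structure LineArrangement (d : ℕ) where
  coeff : Fin d → Fin 3 → ℂ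
  coeff_ne_zero : ∀ i, coeff i ≠ 0
  not_proportional : ∀ i j, i ≠ j → ∀ c : ℂ, coeff i ≠ c • coeff j

namespace LineArrangement

variable {d : ℕ}

/-- The defining polynomial `f = ℓ₁ ⋯ ℓ_d` of the arrangement. -/
def poly (A : LineArrangement d) : MvPolynomial (Fin 3) ℂ :=
  ∏ i, linForm (A.coeff i)

/-- The `i`-th line, as a two-dimensional linear subspace of `ℂ³`. -/
def line (A : LineArrangement d) (i : Fin d) : Submodule ℂ (Fin 3 → ℂ) where
  carrier := {v | A.coeff i ⬝ᵥ v = 0}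
  add_mem' := by
    intro v w hv hw
    simp only [Set.mem_ofPred_eq] at hv hw ⊢
    rw [dotProduct_add, hv, hw, add_zero]
  zero_mem' := by simp
  smul_mem' := by
    intro c v hv
    simp only [Set.mem_ofPred_eq] at hv ⊢
    rw [dotProduct_smul, hv, smul_zero]

/-- The multiplicity of a point `p` of the projective plane: the number of lines of the arrangement
passing through `p`. The intersection points of the arrangement are the points of multiplicity at
least `2`; double points (nodes) are those of multiplicity exactly `2`. -/
def mult (A : LineArrangement d) (p : ℙ ℂ (Fin 3 → ℂ)) : ℕ :=
  {i : Fin d | p.submodule ≤ A.line i}.ncard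

/-- All intersections of subfamilies of lines (as linear subspaces of `ℂ³`), including the empty
intersection `ℂ³`. -/
def flats (A : LineArrangement d) : Set (Submodule ℂ (Fin 3 → ℂ)) :=
  {W | ∃ s : Set (Fin d), W = ⨅ i ∈ s, A.line i}

/-- The intersection lattice: all intersections of lines, ordered by reverse inclusion. -/
abbrev intersectionLattice (A : LineArrangement d) : Type :=
  (A.flats)ᵒᵈ

/-- The stratum `A(L)`: the arrangements of `d` lines whose intersection lattice is isomorphic
to `L`. -/
def stratum (d : ℕ) (L : Type) [PartialOrder L] : Set (LineArrangement d) :=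
  {A | Nonempty (A.intersectionLattice ≃o L)}

/-- The arrangement has one point of multiplicity `m` and apart from that only double points. -/
def HasOnePoint (B : LineArrangement d) (m : ℕ) : Prop :=
  ∃ p, B.mult p = m ∧ ∀ q, q ≠ p → B.mult q ≤ 2

/-- For `m₂ ≥ m₁ ≥ 3`: the arrangement has `d = m₁ + m₂ - 1` lines, one point of multiplicity `m₁`
and one of multiplicity `m₂`, exactly one line containing both, and apart from that only double
points. -/
def HasTwoPointsOnLine (B : LineArrangement d) (m₁ m₂ : ℕ) : Prop :=
  3 ≤ m₁ ∧ m₁ ≤ m₂ ∧ d + 1 = m₁ + m₂ ∧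
    ∃ p q, p ≠ q ∧ B.mult p = m₁ ∧ B.mult q = m₂ ∧
      (∃! i, p.submodule ≤ B.line i ∧ q.submodule ≤ B.line i) ∧
      ∀ r, r ≠ p → r ≠ q → B.mult r ≤ 2

/-- `A ∈ A(L(d, m))`, where `L(d, m)` is the intersection lattice of an arrangement of `d` lines
with one point of multiplicity `m` and apart from that only double points. -/
def InStratumL (A : LineArrangement d) (m : ℕ) : Prop :=
  ∃ B : LineArrangement d, B.HasOnePoint m ∧ A ∈ stratum d B.intersectionLattice

/-- `A ∈ A(L̂(m₁, m₂))`, where `L̂(m₁, m₂)` is the intersection lattice of an arrangement of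
`m₁ + m₂ - 1` lines, with one point of multiplicity `m₁` and one of multiplicity `m₂` on a common
line and apart from that only double points. -/
def InStratumLhat (A : LineArrangement d) (m₁ m₂ : ℕ) : Prop :=
  ∃ B : LineArrangement d, B.HasTwoPointsOnLine m₁ m₂ ∧ A ∈ stratum d B.intersectionLattice

end LineArrangement

/-- The defining polynomial `(x^m - y^m)(x^m - z^m)(y^m - z^m)` of the monomial arrangement
`A(m, m, 3)`. -/
def monomialPoly (m : ℕ) : MvPolynomial (Fin 3) ℂ :=
  (X 0 ^ m - X 1 ^ m) * (X 0 ^ m - X 2 ^ m) * (X 1 ^ m - X 2 ^ m)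

/-- Two plane curves `f = 0` and `h = 0` are linearly (projectively) equivalent if an invertible
linear change of coordinates transforms `f` into a nonzero multiple of `h`. -/
def LinearlyEquivalent (f h : MvPolynomial (Fin 3) ℂ) : Prop :=
  ∃ (g : GL (Fin 3) ℂ) (c : ℂ), c ≠ 0 ∧
    aeval (fun i => linForm (fun j => (g : Matrix (Fin 3) (Fin 3) ℂ) i j)) f = C c * h

end

/-! ### Linear forms and derivations of `ℂ[x, y, z]` -/

/-! A quadratic Jacobian syzygy is a quadratic vector field θ on ℂ³ with θ(f) = 0. Each `ℓ_k` is
prime and occurs once in `f`, so it divides θ(`ℓ_k`). Hence θ(`ℓ_k`) = `K_k ℓ_k` with linear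
cofactors `K_k`, and θ(f) = 0 becomes `∑ K_k = 0` (`exists_invariantField`). Applying θ to a linear
relation between the `ℓ_k` gives a relation between cofactors (`relation`), which turns incidences
into strong constraints.

If four lines are concurrent, or four lines meet a fifth in four distinct points, then all lines but
two pass through one point (`almostPencil_of_four_concurrent`, `almostPencil_of_four_points`);
otherwise the cofactors would all be equal, forcing θ = 0. In an almost pencil the lattice is read
off directly (`AlmostPencil.stratum`), since `mdr f = 2` leaves exactly two lines off the centre.

If neither configuration occurs, the arrangement is `Sparse`. With at most five lines it would again
be an almost pencil. With six or more, four of the lines form a complete quadrilateral and every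
further line is one of its diagonals. The three diagonals are not concurrent in characteristic ≠ 2,
so only two of them occur (`Sparse.exists_braid`). These six lines are unique up to coordinates and
give `A(2,2,3)`. -/

theorem eval_linForm (a x : Fin 3 → ℂ) : eval x (linForm a) = a ⬝ᵥ x := by
  simp [linForm, dotProduct]

theorem linForm_smul (c : ℂ) (a : Fin 3 → ℂ) : linForm (c • a) = C c * linForm a := by
  simp [linForm, Finset.mul_sum, mul_assoc]

theorem pderiv_linForm (i : Fin 3) (a : Fin 3 → ℂ) : pderiv i (linForm a) = C (a i) := by
  fin_cases i <;> simp [linForm, Fin.sum_univ_three, pderiv_X]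

theorem isHomogeneous_linForm (a : Fin 3 → ℂ) : (linForm a).IsHomogeneous 1 := by
  refine IsHomogeneous.sum _ _ _ fun j _ => ?_
  simpa using (isHomogeneous_C (Fin 3) (a j)).mul (isHomogeneous_X ℂ j)

theorem linForm_ne_zero {a : Fin 3 → ℂ} (ha : a ≠ 0) : linForm a ≠ 0 := by
  intro h
  apply ha
  funext i
  have := pderiv_linForm i a
  rw [h, map_zero] at this
  simpa using (C_injective (Fin 3) ℂ (this.symm.trans C_0.symm))

theorem prime_linForm {a : Fin 3 → ℂ} (ha : a ≠ 0) : Prime (linForm a) := by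
  rw [← UniqueFactorizationMonoid.irreducible_iff_prime]
  have hne := linForm_ne_zero ha
  apply irreducible_of_totalDegree_eq_one ((isHomogeneous_linForm a).totalDegree hne)
  intro x hx
  rcases eq_or_ne x 0 with rfl | h
  · exact absurd (MvPolynomial.ext _ _ fun m => by simpa using hx m) hne
  · exact h.isUnit

theorem exists_linForm_of_isHomogeneous_one {q : MvPolynomial (Fin 3) ℂ} (hq : q.IsHomogeneous 1) :
    ∃ k, q = linForm k := by
  refine ⟨fun i => coeff (Finsupp.single i 1) q, ?_⟩
  ext m
  by_cases hm : ∃ i, m = Finsupp.single i 1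
  · obtain ⟨i, rfl⟩ := hm
    simp [linForm, coeff_sum, coeff_C_mul, coeff_X, Finsupp.single_left_inj]
  · have h1 : m.degree ≠ 1 := by
      intro h
      apply hm
      exact (Finsupp.sum_eq_one_iff m).1 h
    rw [hq.coeff_eq_zero h1, (isHomogeneous_linForm _).coeff_eq_zero h1]

/-- In degree `n + m` only the degree `n` part of `q` contributes to the product. This makes
cofactors homogeneous without any result on factors of homogeneous polynomials. -/
theorem homogeneousComponent_mul_eq {q l : MvPolynomial (Fin 3) ℂ} {m n : ℕ}
    (hl : l.IsHomogeneous m) (h : (q * l).IsHomogeneous (n + m)) :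
    homogeneousComponent n q * l = q * l := by
  have key : ∀ i, homogeneousComponent (n + m) (homogeneousComponent i q * l) =
      if i = n then homogeneousComponent i q * l else 0 := by
    intro i
    rw [homogeneousComponent_of_mem ((homogeneousComponent_isHomogeneous i q).mul hl)]
    simp only [Nat.add_right_cancel_iff, eq_comm]
  have h1 := homogeneousComponent_eq_self h
  rw [← sum_homogeneousComponent q, Finset.sum_mul, map_sum, Finset.sum_congr rfl fun i _ => key i,
    Finset.sum_ite_eq', ← Finset.sum_mul, sum_homogeneousComponent] at h1
  rw [← h1]
  split_ifs with hn
  · rfl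
  -- Here `n` exceeds the total degree of `q`, so the sum over components never reaches it and both
  -- sides vanish.
  · rw [homogeneousComponent_eq_zero _ _ (by simpa [Nat.lt_succ_iff] using hn), zero_mul]

theorem leibniz_sum_pderiv (a : Fin 3 → MvPolynomial (Fin 3) ℂ) (f g : MvPolynomial (Fin 3) ℂ) :
    ∑ i, a i * pderiv i (f * g) =
      (∑ i, a i * pderiv i f) * g + f * ∑ i, a i * pderiv i g := by
  simp only [Derivation.leibniz, smul_eq_mul, Fin.sum_univ_three]
  ring

/-- Logarithmic derivatives add, hence so do cofactors. -/
theorem sum_pderiv_prod {ι : Type*} (s : Finset ι) (a : Fin 3 → MvPolynomial (Fin 3) ℂ)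
    (f q : ι → MvPolynomial (Fin 3) ℂ) (h : ∀ k ∈ s, ∑ i, a i * pderiv i (f k) = q k * f k) :
    ∑ i, a i * pderiv i (∏ k ∈ s, f k) = (∑ k ∈ s, q k) * ∏ k ∈ s, f k := by
  classical
  induction s using Finset.induction_on with
  | empty => simp
  | insert k s hk ih =>
    rw [Finset.prod_insert hk, leibniz_sum_pderiv, h k (Finset.mem_insert_self _ _),
      ih fun j hj => h j (Finset.mem_insert_of_mem hj), Finset.sum_insert hk]
    ring

/-! ### Linear algebra in `ℂ³` -/

theorem exists_common_zero (u v : Fin 3 → ℂ) : ∃ p ≠ 0, u ⬝ᵥ p = 0 ∧ v ⬝ᵥ p = 0 := by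
  obtain ⟨p, hp, h⟩ := (Matrix.exists_mulVec_eq_zero_iff (M := Matrix.of ![u, v, 0])).2 (by
    apply Matrix.det_eq_zero_of_row_eq_zero 2; intro j; rfl)
  exact ⟨p, hp, congrFun h 0, congrFun h 1⟩

/-- The lines with coefficient vectors `u`, `v`, `w` have a common point. -/
def Concurrent (u v w : Fin 3 → ℂ) : Prop :=
  ∃ p ≠ 0, u ⬝ᵥ p = 0 ∧ v ⬝ᵥ p = 0 ∧ w ⬝ᵥ p = 0

theorem concurrent_iff_det {u v w : Fin 3 → ℂ} :
    Concurrent u v w ↔ (Matrix.of ![u, v, w]).det = 0 := by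
  rw [← Matrix.exists_mulVec_eq_zero_iff]
  constructor
  · rintro ⟨p, hp, h0, h1, h2⟩
    refine ⟨p, hp, ?_⟩
    ext i
    fin_cases i
    exacts [h0, h1, h2]
  · rintro ⟨p, hp, h⟩
    exact ⟨p, hp, congrFun h 0, congrFun h 1, congrFun h 2⟩

theorem vecMul_of_three (c u v w : Fin 3 → ℂ) :
    Matrix.vecMul c (Matrix.of ![u, v, w]) = c 0 • u + c 1 • v + c 2 • w := by
  ext j
  simp [Matrix.vecMul, dotProduct, Fin.sum_univ_three]

theorem exists_dual {u v w : Fin 3 → ℂ} (h : ¬ Concurrent u v w) (a b c : ℂ) :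
    ∃ x, u ⬝ᵥ x = a ∧ v ⬝ᵥ x = b ∧ w ⬝ᵥ x = c := by
  rw [concurrent_iff_det] at h
  have hM : IsUnit (Matrix.of ![u, v, w]).det := isUnit_iff_ne_zero.2 h
  have key : Matrix.mulVec (Matrix.of ![u, v, w])
      (Matrix.mulVec (Matrix.of ![u, v, w])⁻¹ ![a, b, c]) = ![a, b, c] := by
    rw [Matrix.mulVec_mulVec, Matrix.mul_nonsing_inv _ hM, Matrix.one_mulVec]
  exact ⟨_, congrFun key 0, congrFun key 1, congrFun key 2⟩

theorem exists_combination {u v w : Fin 3 → ℂ} (h : ¬ Concurrent u v w) (z : Fin 3 → ℂ) :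
    ∃ a b c : ℂ, z = a • u + b • v + c • w := by
  rw [concurrent_iff_det] at h
  have hM : IsUnit (Matrix.of ![u, v, w]).det := isUnit_iff_ne_zero.2 h
  let c := Matrix.vecMul z (Matrix.of ![u, v, w])⁻¹
  refine ⟨c 0, c 1, c 2, ?_⟩
  rw [← vecMul_of_three c, Matrix.vecMul_vecMul, Matrix.nonsing_inv_mul _ hM, Matrix.vecMul_one]

theorem Concurrent.exists_combination {u v w : Fin 3 → ℂ} (h : Concurrent u v w)
    (huv : ∀ c : ℂ, u ≠ c • v) (hv : v ≠ 0) : ∃ a b : ℂ, w = a • u + b • v := by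
  rw [concurrent_iff_det, ← Matrix.exists_vecMul_eq_zero_iff] at h
  obtain ⟨c, hc, h⟩ := h
  rw [vecMul_of_three] at h
  rcases eq_or_ne (c 2) 0 with h2 | h2
  · exfalso
    rw [h2, zero_smul, add_zero] at h
    rcases eq_or_ne (c 0) 0 with h0 | h0
    · rw [h0, zero_smul, zero_add] at h
      rcases smul_eq_zero.1 h with h1 | h1
      · apply hc; ext i; fin_cases i <;> assumption
      · exact hv h1
    · apply huv (-(c 1) / c 0)
      rw [div_eq_inv_mul, mul_smul, neg_smul, ← eq_neg_of_add_eq_zero_left h, smul_smul,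
        inv_mul_cancel₀ h0, one_smul]
  · refine ⟨-(c 0) / c 2, -(c 1) / c 2, ?_⟩
    have : c 2 • w = -(c 0) • u + -(c 1) • v := by
      rw [← sub_eq_zero, ← h]; module
    calc w = (c 2)⁻¹ • (c 2 • w) := by rw [smul_smul, inv_mul_cancel₀ h2, one_smul]
      _ = _ := by rw [this]; module

theorem concurrent_self (u w : Fin 3 → ℂ) : Concurrent u w w := by
  obtain ⟨p, hp, h⟩ := exists_common_zero u w
  exact ⟨p, hp, h.1, h.2, h.2⟩

theorem eq_of_dotProduct {u v w a b : Fin 3 → ℂ} (h : ¬ Concurrent u v w)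
    (hu : u ⬝ᵥ a = u ⬝ᵥ b) (hv : v ⬝ᵥ a = v ⬝ᵥ b) (hw : w ⬝ᵥ a = w ⬝ᵥ b) : a = b := by
  by_contra hab
  exact h ⟨a - b, sub_ne_zero.2 hab, by rw [dotProduct_sub, hu, sub_self],
    by rw [dotProduct_sub, hv, sub_self], by rw [dotProduct_sub, hw, sub_self]⟩

theorem exists_dotProduct_ne_zero {u : Fin 3 → ℂ} (hu : u ≠ 0) : ∃ x, u ⬝ᵥ x ≠ 0 := by
  by_contra! h
  exact hu (dotProduct_eq_zero u h)

/-- The ring of polynomial functions on `ℂ³` has no zero divisors, for linear functions. -/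
theorem eq_zero_of_mul_eq_zero {u v : Fin 3 → ℂ} (hu : u ≠ 0)
    (h : ∀ x, (u ⬝ᵥ x) * (v ⬝ᵥ x) = 0) : v = 0 := by
  by_contra hv
  have : linForm u * linForm v = 0 := by
    apply MvPolynomial.funext
    intro x
    simpa [eval_linForm] using h x
  exact mul_ne_zero (linForm_ne_zero hu) (linForm_ne_zero hv) this

theorem eq_smul_of_dotProduct_eq_zero {u v : Fin 3 → ℂ} (hu : u ≠ 0)
    (h : ∀ x, u ⬝ᵥ x = 0 → v ⬝ᵥ x = 0) : ∃ c : ℂ, v = c • u := by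
  obtain ⟨y, hy⟩ := exists_dotProduct_ne_zero hu
  refine ⟨(v ⬝ᵥ y) / (u ⬝ᵥ y), ?_⟩
  refine dotProduct_eq _ _ fun x => ?_
  -- This combination of `x` and `y` is chosen to lie in the kernel of `u`.
  have := h ((u ⬝ᵥ y) • x - (u ⬝ᵥ x) • y) (by
    rw [dotProduct_sub, dotProduct_smul, dotProduct_smul, smul_eq_mul, smul_eq_mul]; ring)
  rw [dotProduct_sub, dotProduct_smul, dotProduct_smul, smul_eq_mul, smul_eq_mul] at this
  rw [smul_dotProduct, smul_eq_mul]
  field_simp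
  linear_combination this

theorem eq_smul_of_linForm_dvd {u v : Fin 3 → ℂ} (hu : u ≠ 0) (h : linForm u ∣ linForm v) :
    ∃ c : ℂ, v = c • u := by
  obtain ⟨q, hq⟩ := h
  refine eq_smul_of_dotProduct_eq_zero hu fun x hx => ?_
  rw [← eval_linForm, hq, map_mul, eval_linForm, hx, zero_mul]

/-! ### Jacobian syzygies of degree at most two -/

theorem exists_syzygy_of_mdr_eq_two {f : MvPolynomial (Fin 3) ℂ} (h : mdr f = 2) :
    ∃ a : Fin 3 → MvPolynomial (Fin 3) ℂ,
      a ≠ 0 ∧ (∀ i, (a i).IsHomogeneous 2) ∧ ∑ i, a i * pderiv i f = 0 := by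
  have hne : Set.Nonempty {r : ℕ | ∃ a : Fin 3 → MvPolynomial (Fin 3) ℂ,
      a ≠ 0 ∧ (∀ i, (a i).IsHomogeneous r) ∧ ∑ i, a i * pderiv i f = 0} := by
    by_contra hne
    rw [Set.not_nonempty_iff_eq_empty] at hne
    -- The infimum of the empty set is 0 by convention, so the value 2 rules it out.
    rw [mdr, hne, Nat.sInf_empty] at h
    exact absurd h (by decide)
  have := Nat.sInf_mem hne
  rw [← mdr, h] at this
  exact this

theorem mdr_le {f : MvPolynomial (Fin 3) ℂ} {r : ℕ} (a : Fin 3 → MvPolynomial (Fin 3) ℂ)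
    (ha : a ≠ 0) (hr : ∀ i, (a i).IsHomogeneous r) (h : ∑ i, a i * pderiv i f = 0) :
    mdr f ≤ r :=
  Nat.sInf_le ⟨a, ha, hr, h⟩

namespace LineArrangement

variable {d : ℕ}

theorem poly_ne_zero (A : LineArrangement d) : A.poly ≠ 0 :=
  Finset.prod_ne_zero_iff.2 fun i _ => linForm_ne_zero (A.coeff_ne_zero i)

theorem sum_pderiv_poly (A : LineArrangement d)
    (a : Fin 3 → MvPolynomial (Fin 3) ℂ) (q : Fin d → MvPolynomial (Fin 3) ℂ)
    (h : ∀ k, ∑ i, a i * C (A.coeff k i) = q k * linForm (A.coeff k)) :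
    ∑ i, a i * pderiv i A.poly = (∑ k, q k) * A.poly := by
  refine sum_pderiv_prod _ _ _ _ fun k _ => ?_
  simpa only [pderiv_linForm] using h k

/-- The constant field in direction `p` kills every linear form of the arrangement. -/
theorem mdr_eq_zero_of_all_through {A : LineArrangement d} {p : Fin 3 → ℂ} (hp : p ≠ 0)
    (h : ∀ i, A.coeff i ⬝ᵥ p = 0) : mdr A.poly = 0 := by
  rw [← Nat.le_zero]
  refine mdr_le (fun j => C (p j)) (fun h0 => hp ?_) (fun i => isHomogeneous_C _ _) ?_
  · funext j
    simpa using congrFun h0 j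
  · rw [A.sum_pderiv_poly _ (fun _ => 0), Finset.sum_const_zero, zero_mul]
    intro k
    have := h k
    rw [dotProduct] at this
    simp only [← C_mul, ← map_sum, mul_comm (p _), this, map_zero, zero_mul]

/-- Take the linear field `s x - d ℓ(x) p`, with `ℓ` the form of line `i₀` and `s = ℓ(p)`. Lines
through `p` have cofactor `s` and line `i₀` has `s - d s`, so the cofactors sum to zero. -/
theorem mdr_le_one_of_through {A : LineArrangement d} {p : Fin 3 → ℂ} {i₀ : Fin d}
    (h₀ : A.coeff i₀ ⬝ᵥ p ≠ 0) (h : ∀ i ≠ i₀, A.coeff i ⬝ᵥ p = 0) : mdr A.poly ≤ 1 := by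
  set s := A.coeff i₀ ⬝ᵥ p with hs
  refine mdr_le (fun j => C s * X j - C (d * p j) * linForm (A.coeff i₀)) (fun hz => ?_)
    (fun i => ?_) ?_
  -- On line `i₀` the field is multiplication by `s ≠ 0`.
  · obtain ⟨x, hx, hx₀, -⟩ := exists_common_zero (A.coeff i₀) 0
    apply hx
    funext j
    have := congrArg (eval x) (congrFun hz j)
    simpa [eval_linForm, hx₀, h₀] using this
  · exact (isHomogeneous_C_mul_X s i).sub ((isHomogeneous_linForm (A.coeff i₀)).C_mul _)
  · rw [A.sum_pderiv_poly _ (fun k => C s - if k = i₀ then C (d * s) else 0)]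
    · rw [Finset.sum_sub_distrib]
      simp
    · intro k
      apply MvPolynomial.funext
      intro x
      have e : ∑ j, (s * x j - d * p j * (A.coeff i₀ ⬝ᵥ x)) * A.coeff k j =
          s * (A.coeff k ⬝ᵥ x) - d * (A.coeff i₀ ⬝ᵥ x) * (A.coeff k ⬝ᵥ p) := by
        simp only [dotProduct, Fin.sum_univ_three]
        ring
      simp only [map_sum, map_mul, map_sub, eval_C, eval_X, eval_linForm, map_natCast] at e ⊢
      rw [e]
      split_ifs with hk
      · subst hk
        simp only [← hs, map_mul, eval_C, map_natCast]
        ring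
      · rw [h k hk, map_zero]
        ring

theorem exists_two_off {A : LineArrangement d} (hA : mdr A.poly = 2) {p : Fin 3 → ℂ}
    (hp : p ≠ 0) : ∃ i j, i ≠ j ∧ A.coeff i ⬝ᵥ p ≠ 0 ∧ A.coeff j ⬝ᵥ p ≠ 0 := by
  by_contra! h
  by_cases h0 : ∀ i, A.coeff i ⬝ᵥ p = 0
  · rw [mdr_eq_zero_of_all_through hp h0] at hA
    exact absurd hA (by decide)
  · push Not at h0
    obtain ⟨i₀, hi₀⟩ := h0
    have := mdr_le_one_of_through hi₀ fun i hi => h i₀ i hi.symm hi₀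
    omega

/-- A quadratic vector field `θ` on `ℂ³` leaving every line of the arrangement invariant, with
linear cofactors `K i` that sum up to zero. -/
structure InvariantField (A : LineArrangement d) where
  θ : (Fin 3 → ℂ) → Fin 3 → ℂ
  K : Fin d → Fin 3 → ℂ
  invariant : ∀ i x, A.coeff i ⬝ᵥ θ x = (K i ⬝ᵥ x) * (A.coeff i ⬝ᵥ x)
  sum_eq_zero : ∑ i, K i = 0
  ne_zero : ∃ x, θ x ≠ 0

theorem exists_invariantField {A : LineArrangement d} (hA : mdr A.poly = 2) :
    Nonempty A.InvariantField := by
  obtain ⟨a, ha, hhom, hsyz⟩ := exists_syzygy_of_mdr_eq_two hA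
  have hdvd : ∀ k, linForm (A.coeff k) ∣ ∑ i, a i * pderiv i (linForm (A.coeff k)) := by
    intro k
    have hp := prime_linForm (A.coeff_ne_zero k)
    have hf : A.poly = linForm (A.coeff k) * ∏ j ∈ Finset.univ.erase k, linForm (A.coeff j) :=
      (Finset.mul_prod_erase _ _ (Finset.mem_univ k)).symm
    rw [hf, leibniz_sum_pderiv] at hsyz
    have h1 : linForm (A.coeff k) ∣ (∑ i, a i * pderiv i (linForm (A.coeff k))) *
        ∏ j ∈ Finset.univ.erase k, linForm (A.coeff j) := by
      rw [eq_neg_of_add_eq_zero_left hsyz]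
      exact (Dvd.intro _ rfl).neg_right
    refine (hp.dvd_or_dvd h1).resolve_right fun h2 => ?_
    obtain ⟨j, hj, h3⟩ := hp.exists_mem_finset_dvd h2
    obtain ⟨c, hc⟩ := eq_smul_of_linForm_dvd (A.coeff_ne_zero k) h3
    exact A.not_proportional j k (Finset.ne_of_mem_erase hj) c hc
  have hq : ∀ k, ∃ κ : Fin 3 → ℂ,
      ∑ i, a i * C (A.coeff k i) = linForm κ * linForm (A.coeff k) := by
    intro k
    obtain ⟨q, hq⟩ := hdvd k
    simp only [pderiv_linForm] at hq
    have h2 : (∑ i, a i * C (A.coeff k i)).IsHomogeneous (1 + 1) := by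
      refine IsHomogeneous.sum _ _ _ fun j _ => ?_
      simpa using (hhom j).mul (isHomogeneous_C (Fin 3) (A.coeff k j))
    obtain ⟨κ, hκ⟩ := exists_linForm_of_isHomogeneous_one (homogeneousComponent_isHomogeneous 1 q)
    rw [mul_comm] at hq
    refine ⟨κ, ?_⟩
    rw [hq] at h2 ⊢
    rw [← hκ, homogeneousComponent_mul_eq (isHomogeneous_linForm _) h2]
  choose K hK using hq
  refine ⟨⟨fun x i => eval x (a i), K, fun k x => ?_, ?_, ?_⟩⟩
  · have := congrArg (eval x) (hK k)
    simp only [map_sum, map_mul, eval_C, eval_linForm] at this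
    rw [← this, dotProduct]
    exact Finset.sum_congr rfl fun _ _ => mul_comm _ _
  · rw [A.sum_pderiv_poly a _ hK] at hsyz
    have h0 := (mul_eq_zero.1 hsyz).resolve_right A.poly_ne_zero
    refine dotProduct_eq_zero _ fun x => ?_
    have := congrArg (eval x) h0
    simpa only [map_sum, eval_linForm, map_zero, sum_dotProduct] using this
  · by_contra! h
    apply ha
    funext i
    apply MvPolynomial.funext
    intro x
    simpa using congrFun (h x) i

end LineArrangement

/-! ### Linear syzygies between linear forms -/

theorem concurrent_of_eq_combination {u v w : Fin 3 → ℂ} {a b : ℂ} (h : w = a • u + b • v) :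
    Concurrent u v w := by
  obtain ⟨p, hp, hu, hv⟩ := exists_common_zero u v
  refine ⟨p, hp, hu, hv, ?_⟩
  rw [h, add_dotProduct, smul_dotProduct, smul_dotProduct, hu, hv, smul_zero, smul_zero, add_zero]

theorem exists_not_concurrent {u w : Fin 3 → ℂ} (h : ∀ c : ℂ, u ≠ c • w) (hw : w ≠ 0) :
    ∃ v, ¬ Concurrent u v w := by
  obtain ⟨p, hp, hu, hw'⟩ := exists_common_zero u w
  obtain ⟨v, hv⟩ := exists_dotProduct_ne_zero hp
  refine ⟨v, fun ⟨q, hq, h1, h2, h3⟩ => ?_⟩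
  obtain ⟨a, b, rfl⟩ := Concurrent.exists_combination ⟨q, hq, h1, h3, h2⟩ h hw
  apply hv
  rw [dotProduct_comm, add_dotProduct, smul_dotProduct, smul_dotProduct, hu, hw', smul_zero,
    smul_zero, add_zero]

/-- Two coprime linear forms have only the Koszul syzygy. -/
theorem eq_smul_of_mul_add_mul_eq_zero {u v r s : Fin 3 → ℂ} (hu : u ≠ 0)
    (huv : ∀ c : ℂ, v ≠ c • u) (h : ∀ x, (u ⬝ᵥ x) * (r ⬝ᵥ x) + (v ⬝ᵥ x) * (s ⬝ᵥ x) = 0) :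
    ∃ c : ℂ, s = c • u ∧ r = -c • v := by
  have h1 : linForm u * linForm r + linForm v * linForm s = 0 := by
    apply MvPolynomial.funext
    intro x
    simpa [eval_linForm] using h x
  have h2 : linForm u ∣ linForm v * linForm s := by
    rw [eq_neg_of_add_eq_zero_right h1]
    exact (Dvd.intro _ rfl).neg_right
  rcases (prime_linForm hu).dvd_or_dvd h2 with h3 | h3
  · obtain ⟨c, hc⟩ := eq_smul_of_linForm_dvd hu h3
    exact absurd hc (huv c)
  · obtain ⟨c, rfl⟩ := eq_smul_of_linForm_dvd hu h3
    refine ⟨c, rfl, ?_⟩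
    have : r + c • v = 0 := by
      refine eq_zero_of_mul_eq_zero hu fun x => ?_
      rw [← h x, add_dotProduct, smul_dotProduct, smul_dotProduct, smul_eq_mul, smul_eq_mul]
      ring
    rw [neg_smul]
    exact eq_neg_of_add_eq_zero_left this

/-- The Koszul statement modulo `w`: on the plane `w = 0`, a binary quadratic form vanishes once it
does at two basis vectors and their sum. -/
theorem eq_combination_of_mul_add_mul_eq_zero {u v w r s : Fin 3 → ℂ}
    (huv : ¬ Concurrent u v w)
    (h : ∀ x, w ⬝ᵥ x = 0 → (u ⬝ᵥ x) * (r ⬝ᵥ x) + (v ⬝ᵥ x) * (s ⬝ᵥ x) = 0) :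
    ∃ c e e' : ℂ, r = c • v + e • w ∧ s = -c • u + e' • w := by
  obtain ⟨a, b, e, rfl⟩ := exists_combination huv r
  obtain ⟨a', b', e', rfl⟩ := exists_combination huv s
  obtain ⟨x, hx1, hx2, hx3⟩ := exists_dual huv 1 0 0
  obtain ⟨y, hy1, hy2, hy3⟩ := exists_dual huv 0 1 0
  have e1 := h x hx3
  have e2 := h y hy3
  have e3 := h (x + y) (by rw [dotProduct_add, hx3, hy3, add_zero])
  simp only [add_dotProduct, dotProduct_add, smul_dotProduct, hx1, hx2, hx3, hy1, hy2, hy3,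
    smul_eq_mul] at e1 e2 e3
  obtain rfl : a = 0 := by linear_combination e1
  obtain rfl : b' = 0 := by linear_combination e2
  obtain rfl : a' = -b := by linear_combination e3
  exact ⟨b, e, e', by module, by module⟩

theorem eq_smul_of_mul_eq_zero {u w r : Fin 3 → ℂ} (hu : ∀ c : ℂ, u ≠ c • w) (hw : w ≠ 0)
    (h : ∀ x, w ⬝ᵥ x = 0 → (u ⬝ᵥ x) * (r ⬝ᵥ x) = 0) : ∃ e : ℂ, r = e • w := by
  obtain ⟨v, hv⟩ := exists_not_concurrent hu hw
  obtain ⟨c, e, e', hr, hs⟩ := eq_combination_of_mul_add_mul_eq_zero (s := 0) hv fun x hx => by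
    rw [h x hx, zero_dotProduct, mul_zero, add_zero]
  refine ⟨e, ?_⟩
  rcases eq_or_ne c 0 with rfl | hc
  · rw [hr]; module
  · exfalso
    apply hu (e' / c)
    have : c • u = e' • w := by rw [← sub_eq_zero, ← neg_eq_zero, hs]; module
    rw [div_eq_inv_mul, mul_smul, ← this, smul_smul, inv_mul_cancel₀ hc, one_smul]

namespace LineArrangement

variable {d : ℕ} {A : LineArrangement d}

theorem eq_combination {i j k : Fin d} (hij : i ≠ j)
    (h : Concurrent (A.coeff i) (A.coeff j) (A.coeff k)) :
    ∃ a b : ℂ, A.coeff k = a • A.coeff i + b • A.coeff j :=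
  h.exists_combination (A.not_proportional i j hij) (A.coeff_ne_zero j)

/-- A line concurrent with two distinct lines through `p` passes through `p`. -/
theorem dotProduct_eq_zero_of_concurrent {i j k : Fin d} (hij : i ≠ j)
    (h : Concurrent (A.coeff i) (A.coeff j) (A.coeff k)) {p : Fin 3 → ℂ}
    (hi : A.coeff i ⬝ᵥ p = 0) (hj : A.coeff j ⬝ᵥ p = 0) : A.coeff k ⬝ᵥ p = 0 := by
  obtain ⟨a, b, hk⟩ := eq_combination hij h
  rw [hk, add_dotProduct, smul_dotProduct, smul_dotProduct, hi, hj, smul_zero, smul_zero,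
    add_zero]

theorem smul_coeff_eq_zero {i j : Fin d} (hij : i ≠ j) {a b : ℂ}
    (h : a • A.coeff i = b • A.coeff j) : a = 0 := by
  by_contra ha
  apply A.not_proportional i j hij (b / a)
  rw [div_eq_inv_mul, mul_smul, ← h, smul_smul, inv_mul_cancel₀ ha, one_smul]

/-- All but at most two of the lines pass through a common point. -/
def AlmostPencil (A : LineArrangement d) : Prop :=
  ∃ p ≠ 0, ∃ a b, ∀ m, m ≠ a → m ≠ b → A.coeff m ⬝ᵥ p = 0

/-! ### Incidence constraints from the cofactors -/

namespace InvariantField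

/-- Apply θ to the linear relation and subtract `K m` times the relation itself. -/
theorem relation (F : A.InvariantField) {i j k m : Fin d} {a b c : ℂ}
    (h : A.coeff m = a • A.coeff i + b • A.coeff j + c • A.coeff k) (x : Fin 3 → ℂ) :
    a * (A.coeff i ⬝ᵥ x) * ((F.K i - F.K m) ⬝ᵥ x) + b * (A.coeff j ⬝ᵥ x) * ((F.K j - F.K m) ⬝ᵥ x)
      + c * (A.coeff k ⬝ᵥ x) * ((F.K k - F.K m) ⬝ᵥ x) = 0 := by
  have h1 := F.invariant m x
  have h2 : A.coeff m ⬝ᵥ x =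
      a * (A.coeff i ⬝ᵥ x) + b * (A.coeff j ⬝ᵥ x) + c * (A.coeff k ⬝ᵥ x) := by
    rw [h]; simp only [add_dotProduct, smul_dotProduct, smul_eq_mul]
  have h3 : A.coeff m ⬝ᵥ F.θ x =
      a * (A.coeff i ⬝ᵥ F.θ x) + b * (A.coeff j ⬝ᵥ F.θ x) + c * (A.coeff k ⬝ᵥ F.θ x) := by
    rw [h]; simp only [add_dotProduct, smul_dotProduct, smul_eq_mul]
  rw [h3, F.invariant i, F.invariant j, F.invariant k, h2] at h1
  simp only [sub_dotProduct]
  linear_combination h1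

theorem relation_two (F : A.InvariantField) {i j m : Fin d} {a b : ℂ}
    (h : A.coeff m = a • A.coeff i + b • A.coeff j) (x : Fin 3 → ℂ) :
    a * (A.coeff i ⬝ᵥ x) * ((F.K i - F.K m) ⬝ᵥ x)
      + b * (A.coeff j ⬝ᵥ x) * ((F.K j - F.K m) ⬝ᵥ x) = 0 := by
  simpa using F.relation (k := i) (c := 0) (by rw [h, zero_smul, add_zero]) x

/-- Since the cofactors sum to zero, a common value is 0. Then three independent forms kill θ, so θ
= 0. -/
theorem cofactor_not_constant (F : A.InvariantField) {i j k : Fin d}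
    (h : ¬ Concurrent (A.coeff i) (A.coeff j) (A.coeff k)) (κ : Fin 3 → ℂ)
    (hκ : ∀ m, F.K m = κ) : False := by
  have hd : (d : ℂ) ≠ 0 := by
    have := i.pos
    exact_mod_cast this.ne'
  have h0 : κ = 0 := by
    have := F.sum_eq_zero
    simp only [hκ, Finset.sum_const, Finset.card_univ, Fintype.card_fin] at this
    rw [← Nat.cast_smul_eq_nsmul ℂ] at this
    exact (smul_eq_zero.1 this).resolve_left hd
  obtain ⟨x, hx⟩ := F.ne_zero
  apply hx
  have key : ∀ m, A.coeff m ⬝ᵥ F.θ x = A.coeff m ⬝ᵥ 0 := fun m => by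
    rw [F.invariant, hκ, h0, zero_dotProduct, zero_mul, dotProduct_zero]
  exact eq_of_dotProduct h (key i) (key j) (key k)

/-- Write `ℓ_k = a ℓ_i + b ℓ_j`. The Koszul syzygy makes `K i - K k` a multiple of `ℓ_j` and `K j -
K k` one of `ℓ_i`, with factors matched so that the difference is a multiple of `ℓ_k`. -/
theorem cofactor_sub_of_concurrent (F : A.InvariantField) {i j k : Fin d}
    (hij : i ≠ j) (hik : i ≠ k) (hjk : j ≠ k)
    (h : Concurrent (A.coeff i) (A.coeff j) (A.coeff k)) :
    ∃ c : ℂ, F.K i - F.K j = c • A.coeff k := by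
  obtain ⟨a, b, hk⟩ := eq_combination hij h
  have ha : a ≠ 0 := by
    rintro rfl
    exact A.not_proportional k j hjk.symm b (by rw [hk]; module)
  have hb : b ≠ 0 := by
    rintro rfl
    exact A.not_proportional k i hik.symm a (by rw [hk]; module)
  obtain ⟨c, hs, hr⟩ := eq_smul_of_mul_add_mul_eq_zero (u := A.coeff i) (v := A.coeff j)
    (r := a • (F.K i - F.K k)) (s := b • (F.K j - F.K k)) (A.coeff_ne_zero i)
    (A.not_proportional j i hij.symm) fun x => by
      rw [← F.relation_two hk x, smul_dotProduct, smul_dotProduct, smul_eq_mul, smul_eq_mul]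
      ring
  refine ⟨-c / (a * b), ?_⟩
  rw [hk]
  have hs' : F.K j - F.K k = b⁻¹ • c • A.coeff i := by
    rw [← hs, smul_smul, inv_mul_cancel₀ hb, one_smul]
  have hr' : F.K i - F.K k = a⁻¹ • -c • A.coeff j := by
    rw [← hr, smul_smul, inv_mul_cancel₀ ha, one_smul]
  rw [← sub_sub_sub_cancel_right (F.K i) (F.K j) (F.K k), hs', hr']
  match_scalars <;> field_simp

/-- `K i - K j` is a multiple of both `ℓ_k` and `ℓ_l`, hence zero, and all lines through `p` then
share one cofactor. With three lines off `p`, each of these would share it too. -/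
theorem almostPencil_of_four_concurrent (F : A.InvariantField)
    {p : Fin 3 → ℂ} (hp : p ≠ 0) {i j k l : Fin d}
    (hij : i ≠ j) (hik : i ≠ k) (hil : i ≠ l) (hjk : j ≠ k) (hjl : j ≠ l) (hkl : k ≠ l)
    (hi : A.coeff i ⬝ᵥ p = 0) (hj : A.coeff j ⬝ᵥ p = 0) (hk : A.coeff k ⬝ᵥ p = 0)
    (hl : A.coeff l ⬝ᵥ p = 0) : A.AlmostPencil := by
  obtain ⟨c, hc⟩ := F.cofactor_sub_of_concurrent hij hik hjk ⟨p, hp, hi, hj, hk⟩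
  obtain ⟨c', hc'⟩ := F.cofactor_sub_of_concurrent hij hil hjl ⟨p, hp, hi, hj, hl⟩
  have hKij : F.K i = F.K j := by
    rw [smul_coeff_eq_zero hkl (hc.symm.trans hc'), zero_smul] at hc
    exact sub_eq_zero.1 hc
  have through : ∀ m, A.coeff m ⬝ᵥ p = 0 → F.K m = F.K i := by
    intro m hm
    obtain ⟨a, b, h⟩ := eq_combination hij (k := m) ⟨p, hp, hi, hj, hm⟩
    have : F.K i - F.K m = 0 := by
      refine eq_zero_of_mul_eq_zero (A.coeff_ne_zero m) fun x => ?_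
      have hx := F.relation_two h x
      rw [← hKij] at hx
      rw [h, add_dotProduct, smul_dotProduct, smul_dotProduct, smul_eq_mul, smul_eq_mul]
      linear_combination hx
    exact (sub_eq_zero.1 this).symm
  have hnc : ∀ m, A.coeff m ⬝ᵥ p ≠ 0 → ¬ Concurrent (A.coeff i) (A.coeff j) (A.coeff m) :=
    fun m hm h => hm (dotProduct_eq_zero_of_concurrent hij h hi hj)
  have off : ∀ a b, a ≠ b → A.coeff a ⬝ᵥ p ≠ 0 → A.coeff b ⬝ᵥ p ≠ 0 →
      ∃ c : ℂ, F.K a - F.K i = c • A.coeff b := by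
    intro a b hab ha hb
    obtain ⟨t, u, s, h⟩ := exists_combination (hnc a ha) (A.coeff b)
    have hs : s ≠ 0 := by
      rintro rfl
      apply hb
      rw [h, add_dotProduct, add_dotProduct, smul_dotProduct, smul_dotProduct, hi, hj]
      simp
    -- Because `K i = K j`, the relation collapses to `ℓ_b (K i - K b) + s ℓ_a (K a - K i) = 0`.
    obtain ⟨c, h1, -⟩ := eq_smul_of_mul_add_mul_eq_zero (u := A.coeff b) (v := s • A.coeff a)
      (r := -(F.K b - F.K i)) (s := F.K a - F.K i) (A.coeff_ne_zero b)
      (fun c hc => hs (smul_coeff_eq_zero hab hc)) fun x => by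
        have h2 : A.coeff b ⬝ᵥ x =
            t * (A.coeff i ⬝ᵥ x) + u * (A.coeff j ⬝ᵥ x) + s * (A.coeff a ⬝ᵥ x) := by
          rw [h]; simp only [add_dotProduct, smul_dotProduct, smul_eq_mul]
        have hx := F.relation h x
        rw [← hKij] at hx
        simp only [sub_dotProduct, neg_dotProduct, smul_dotProduct, smul_eq_mul, h2] at hx ⊢
        linear_combination hx
    exact ⟨c, h1⟩
  by_contra hcon
  have third : ∀ a b, ∃ m, m ≠ a ∧ m ≠ b ∧ A.coeff m ⬝ᵥ p ≠ 0 := by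
    intro a b
    by_contra! h
    exact hcon ⟨p, hp, a, b, h⟩
  obtain ⟨a, -, -, ha⟩ := third i i
  refine F.cofactor_not_constant (hnc a ha) (F.K i) fun m => ?_
  by_cases hm : A.coeff m ⬝ᵥ p = 0
  · exact through m hm
  · obtain ⟨b, hbm, -, hb⟩ := third m m
    obtain ⟨c, hcm, hcb, hc⟩ := third m b
    obtain ⟨s, hs⟩ := off m b hbm.symm hm hb
    obtain ⟨t, ht⟩ := off m c hcm.symm hm hc
    rw [smul_coeff_eq_zero hcb.symm (hs.symm.trans ht), zero_smul] at hs
    exact sub_eq_zero.1 hs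

/-- This is `cofactor_sub_of_concurrent` modulo `ℓ_o`: on the line `o` the three forms become
dependent and pairwise independent. -/
theorem cofactor_sub_of_not_concurrent (F : A.InvariantField) {o i j k : Fin d}
    (hij : ¬ Concurrent (A.coeff i) (A.coeff j) (A.coeff o))
    (hik : ¬ Concurrent (A.coeff i) (A.coeff o) (A.coeff k))
    (hjk : ¬ Concurrent (A.coeff j) (A.coeff o) (A.coeff k)) :
    ∃ c e : ℂ, F.K i - F.K j = c • A.coeff k + e • A.coeff o := by
  obtain ⟨a, b, c, hk⟩ := exists_combination hij (A.coeff k)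
  have ha : a ≠ 0 := by
    rintro rfl
    exact hjk (concurrent_of_eq_combination (a := b) (b := c) (by rw [hk]; module))
  have hb : b ≠ 0 := by
    rintro rfl
    exact hik (concurrent_of_eq_combination (a := a) (b := c) (by rw [hk]; module))
  obtain ⟨t, e, e', hr, hs⟩ := eq_combination_of_mul_add_mul_eq_zero
    (r := a • (F.K i - F.K k)) (s := b • (F.K j - F.K k)) hij fun x hx => by
      have := F.relation hk x
      rw [hx] at this
      rw [smul_dotProduct, smul_dotProduct, smul_eq_mul, smul_eq_mul]
      linear_combination this
  have hs' : F.K j - F.K k = b⁻¹ • (-t • A.coeff i + e' • A.coeff o) := by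
    rw [← hs, smul_smul, inv_mul_cancel₀ hb, one_smul]
  have hr' : F.K i - F.K k = a⁻¹ • (t • A.coeff j + e • A.coeff o) := by
    rw [← hr, smul_smul, inv_mul_cancel₀ ha, one_smul]
  refine ⟨t / (a * b), e / a - e' / b - t * c / (a * b), ?_⟩
  rw [← sub_sub_sub_cancel_right (F.K i) (F.K j) (F.K k), hs', hr', hk]
  match_scalars <;> field_simp; ring

/-- Four lines meeting a fifth one in four distinct points. -/
theorem almostPencil_of_four_points (F : A.InvariantField) (hA : mdr A.poly = 2) {o i j k l : Fin d}
    (hio : i ≠ o) (hjo : j ≠ o) (hko : k ≠ o) (hlo : l ≠ o) (hkl' : k ≠ l)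
    (hik' : i ≠ k) (hjk' : j ≠ k) (hil' : i ≠ l) (hjl' : j ≠ l)
    (hij : ¬ Concurrent (A.coeff o) (A.coeff i) (A.coeff j))
    (hik : ¬ Concurrent (A.coeff o) (A.coeff i) (A.coeff k))
    (hil : ¬ Concurrent (A.coeff o) (A.coeff i) (A.coeff l))
    (hjk : ¬ Concurrent (A.coeff o) (A.coeff j) (A.coeff k))
    (hjl : ¬ Concurrent (A.coeff o) (A.coeff j) (A.coeff l))
    (hkl : ¬ Concurrent (A.coeff o) (A.coeff k) (A.coeff l)) : A.AlmostPencil := by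
  have hij₁ : ¬ Concurrent (A.coeff i) (A.coeff j) (A.coeff o) :=
    fun ⟨p, hp, h1, h2, h3⟩ => hij ⟨p, hp, h3, h1, h2⟩
  have swap : ∀ {a b c : Fin 3 → ℂ}, ¬ Concurrent a b c → ¬ Concurrent b a c :=
    fun h ⟨p, hp, h1, h2, h3⟩ => h ⟨p, hp, h2, h1, h3⟩
  obtain ⟨c₁, e₁, h₁⟩ := F.cofactor_sub_of_not_concurrent hij₁ (swap hik) (swap hjk)
  obtain ⟨c₂, e₂, h₂⟩ := F.cofactor_sub_of_not_concurrent hij₁ (swap hil) (swap hjl)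
  -- `K i - K j` lies in the spans of `ℓ_k, ℓ_o` and of `ℓ_l, ℓ_o`, which meet only in multiples of
  -- `ℓ_o`.
  have hc₁ : c₁ = 0 := by
    by_contra hc
    apply hkl
    have h3 : c₁ • A.coeff k = (e₂ - e₁) • A.coeff o + c₂ • A.coeff l := by
      have := h₁.symm.trans h₂
      rw [← sub_eq_zero] at this ⊢
      rw [← this]; module
    have h4 : A.coeff k = (c₁⁻¹ * (e₂ - e₁)) • A.coeff o + (c₁⁻¹ * c₂) • A.coeff l := by
      rw [mul_smul, mul_smul, ← smul_add, ← h3, smul_smul, inv_mul_cancel₀ hc, one_smul]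
    obtain ⟨p, hp, h5, h6, h7⟩ := concurrent_of_eq_combination h4
    exact ⟨p, hp, h5, h7, h6⟩
  rw [hc₁, zero_smul, zero_add] at h₁
  -- On `ℓ_o = 0` one has `K i = K j`, so the relation reads `ℓ_m (K m - K i) = 0` there. At `m = o`
  -- the scalar carries no information.
  have mod : ∀ m, ∃ e : ℂ, m ≠ o → F.K m = F.K i + e • A.coeff o := by
    intro m
    by_cases hm : m = o
    · exact ⟨0, fun h => absurd hm h⟩
    obtain ⟨a, b, c, h⟩ := exists_combination hij₁ (A.coeff m)
    obtain ⟨e, he⟩ := eq_smul_of_mul_eq_zero (u := A.coeff m) (w := A.coeff o)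
      (r := F.K m - F.K i) (A.not_proportional m o hm) (A.coeff_ne_zero o) fun x hx => by
        have h2 : A.coeff m ⬝ᵥ x = a * (A.coeff i ⬝ᵥ x) + b * (A.coeff j ⬝ᵥ x) := by
          rw [h]; simp only [add_dotProduct, smul_dotProduct, smul_eq_mul, hx, mul_zero, add_zero]
        have h3 := F.relation h x
        have h4 : (F.K i - F.K j) ⬝ᵥ x = 0 := by rw [h₁, smul_dotProduct, hx, smul_zero]
        simp only [sub_dotProduct, hx] at h3 h4 ⊢
        rw [h2]
        linear_combination -h3 - b * (A.coeff j ⬝ᵥ x) * h4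
    exact ⟨e, fun _ => by rw [← he]; abel⟩
  choose c hc using mod
  -- Dividing the relation by `ℓ_o` shows that `ℓ_m` is an eigenvector, with eigenvalue `c m`, of
  -- the diagonal map with eigenvalues `c i, c j, c k` on `ℓ_i, ℓ_j, ℓ_k`.
  have eig : ∀ i j k m, i ≠ o → j ≠ o → k ≠ o → m ≠ o →
      ¬ Concurrent (A.coeff i) (A.coeff j) (A.coeff k) → ∃ α β γ : ℂ,
      A.coeff m = α • A.coeff i + β • A.coeff j + γ • A.coeff k ∧
      α * (c i - c m) = 0 ∧ β * (c j - c m) = 0 ∧ γ * (c k - c m) = 0 := by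
    intro i j k m hi hj hk hm h
    obtain ⟨α, β, γ, hm'⟩ := exists_combination h (A.coeff m)
    refine ⟨α, β, γ, hm', ?_⟩
    have h0 : (α * (c i - c m)) • A.coeff i + (β * (c j - c m)) • A.coeff j +
        (γ * (c k - c m)) • A.coeff k = 0 := by
      refine eq_zero_of_mul_eq_zero (A.coeff_ne_zero o) fun x => ?_
      have := F.relation hm' x
      rw [hc i hi, hc j hj, hc k hk, hc m hm] at this
      simp only [add_dotProduct, sub_dotProduct, smul_dotProduct, smul_eq_mul] at this ⊢
      linear_combination this
    have coord : ∀ x, α * (c i - c m) * (A.coeff i ⬝ᵥ x) + β * (c j - c m) * (A.coeff j ⬝ᵥ x) +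
        γ * (c k - c m) * (A.coeff k ⬝ᵥ x) = 0 := by
      intro x
      have := congrArg (· ⬝ᵥ x) h0
      simpa only [add_dotProduct, smul_dotProduct, smul_eq_mul, zero_dotProduct] using this
    obtain ⟨x, x1, x2, x3⟩ := exists_dual h 1 0 0
    obtain ⟨y, y1, y2, y3⟩ := exists_dual h 0 1 0
    obtain ⟨z, z1, z2, z3⟩ := exists_dual h 0 0 1
    have hx := coord x
    have hy := coord y
    have hz := coord z
    rw [x1, x2, x3] at hx
    rw [y1, y2, y3] at hy
    rw [z1, z2, z3] at hz
    exact ⟨by linear_combination hx, by linear_combination hy, by linear_combination hz⟩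
  -- If all three eigenvalues agree, the cofactors are constant, which is impossible. Otherwise an
  -- eigenvector not proportional to `ℓ_k` lies in the span of `ℓ_i, ℓ_j`, so its line passes
  -- through their common point.
  have core : ∀ i j k, i ≠ o → j ≠ o → k ≠ o →
      ¬ Concurrent (A.coeff i) (A.coeff j) (A.coeff k) → c i = c j → A.AlmostPencil := by
    intro i j k hi hj hk h hcij
    by_cases hck : c k = c i
    · exfalso
      have hall : ∀ m, m ≠ o → F.K m = F.K i := by
        intro m hm
        rw [hc m hm, hc i hi]
        congr 2
        by_contra hne
        have hne' : c i - c m ≠ 0 := sub_ne_zero.2 (Ne.symm hne)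
        obtain ⟨α, β, γ, h0, h1, h2, h3⟩ := eig i j k m hi hj hk hm h
        rw [← hcij] at h2
        rw [hck] at h3
        apply A.coeff_ne_zero m
        rw [h0, (mul_eq_zero.1 h1).resolve_right hne', (mul_eq_zero.1 h2).resolve_right hne',
          (mul_eq_zero.1 h3).resolve_right hne']
        simp
      refine F.cofactor_not_constant h (F.K i) fun m => ?_
      by_cases hm : m = o
      · subst hm
        obtain ⟨α, β, γ, h0⟩ := exists_combination h (A.coeff m)
        have : F.K m - F.K i = 0 := by
          refine eq_zero_of_mul_eq_zero (A.coeff_ne_zero m) fun x => ?_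
          have hx := F.relation h0 x
          rw [hall j hj, hall k hk] at hx
          have h2 : A.coeff m ⬝ᵥ x =
              α * (A.coeff i ⬝ᵥ x) + β * (A.coeff j ⬝ᵥ x) + γ * (A.coeff k ⬝ᵥ x) := by
            rw [h0]; simp only [add_dotProduct, smul_dotProduct, smul_eq_mul]
          rw [h2]
          simp only [sub_dotProduct] at hx ⊢
          linear_combination -hx
        exact sub_eq_zero.1 this
      · exact hall m hm
    · obtain ⟨p, hp, h1, h2⟩ := exists_common_zero (A.coeff i) (A.coeff j)
      refine ⟨p, hp, o, k, fun m hm hmk => ?_⟩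
      obtain ⟨α, β, γ, h0, h3, h4, h5⟩ := eig i j k m hi hj hk hm h
      have hγ : γ = 0 := by
        by_contra hγ
        have h6 := sub_eq_zero.1 ((mul_eq_zero.1 h5).resolve_left hγ)
        rw [← hcij, ← h6] at h4
        rw [← h6] at h3
        have hne : c i - c k ≠ 0 := sub_ne_zero.2 (Ne.symm hck)
        apply A.not_proportional m k hmk γ
        rw [h0, (mul_eq_zero.1 h3).resolve_right hne, (mul_eq_zero.1 h4).resolve_right hne]
        module
      rw [h0, hγ, add_dotProduct, add_dotProduct, smul_dotProduct, smul_dotProduct, h1, h2]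
      simp
  obtain ⟨p, hp, hpi, hpj⟩ := exists_common_zero (A.coeff i) (A.coeff j)
  have hij' : i ≠ j := by
    rintro rfl
    exact hij (concurrent_self _ _)
  obtain ⟨n, hno, hn⟩ : ∃ n, n ≠ o ∧ A.coeff n ⬝ᵥ p ≠ 0 := by
    obtain ⟨s, t, hst, hs, ht⟩ := exists_two_off hA hp
    by_cases h : s = o
    · exact ⟨t, fun h' => hst (h.trans h'.symm), ht⟩
    · exact ⟨s, h, hs⟩
  have hijn : ¬ Concurrent (A.coeff i) (A.coeff j) (A.coeff n) :=
    fun h => hn (dotProduct_eq_zero_of_concurrent hij' h hpi hpj)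
  -- A further line has at least two nonzero coordinates in the basis `ℓ_i, ℓ_j, ℓ_n`, so two
  -- eigenvalues coincide and `core` applies.
  obtain ⟨m, hmo, hmi, hmj, hmn⟩ : ∃ m, m ≠ o ∧ m ≠ i ∧ m ≠ j ∧ m ≠ n := by
    by_cases h : k = n
    · exact ⟨l, hlo, hil'.symm, hjl'.symm, fun h' => hkl' (h.trans h'.symm)⟩
    · exact ⟨k, hko, hik'.symm, hjk'.symm, h⟩
  obtain ⟨α, β, γ, h0, h1, h2, h3⟩ := eig i j n m hio hjo hno hmo hijn
  by_cases hα : α = 0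
  · have hβ : β ≠ 0 := by
      rintro rfl
      exact A.not_proportional m n hmn γ (by rw [h0, hα]; module)
    have hγ : γ ≠ 0 := by
      rintro rfl
      exact A.not_proportional m j hmj β (by rw [h0, hα]; module)
    have e2 := sub_eq_zero.1 ((mul_eq_zero.1 h2).resolve_left hβ)
    have e3 := sub_eq_zero.1 ((mul_eq_zero.1 h3).resolve_left hγ)
    exact core j n i hjo hno hio (fun ⟨p, hp, a, b, c⟩ => hijn ⟨p, hp, c, a, b⟩) (e2.trans e3.symm)
  have e1 := sub_eq_zero.1 ((mul_eq_zero.1 h1).resolve_left hα)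
  by_cases hβ : β = 0
  · have hγ : γ ≠ 0 := by
      rintro rfl
      exact A.not_proportional m i hmi α (by rw [h0, hβ]; module)
    have e3 := sub_eq_zero.1 ((mul_eq_zero.1 h3).resolve_left hγ)
    exact core i n j hio hno hjo (fun ⟨p, hp, a, b, c⟩ => hijn ⟨p, hp, a, c, b⟩) (e1.trans e3.symm)
  · have e2 := sub_eq_zero.1 ((mul_eq_zero.1 h2).resolve_left hβ)
    exact core i j n hio hjo hno hijn (e1.trans e2.symm)

end InvariantField

end LineArrangement

namespace LineArrangement

variable {d : ℕ} {A : LineArrangement d}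

/-! ### Almost pencils -/

/-- Two lines meet in a point `q`, and two more must avoid `q`. The vector of ones only serves to
produce the first two. -/
theorem four_le_of_mdr_eq_two (hA : mdr A.poly = 2) : 4 ≤ d := by
  obtain ⟨i, j, hij, -, -⟩ := exists_two_off hA (p := fun _ => 1)
    (fun h => one_ne_zero (congrFun h 0))
  obtain ⟨q, hq, hi, hj⟩ := exists_common_zero (A.coeff i) (A.coeff j)
  obtain ⟨k, l, hkl, hk, hl⟩ := exists_two_off hA hq
  have hne : ∀ {m n}, A.coeff m ⬝ᵥ q = 0 → A.coeff n ⬝ᵥ q ≠ 0 → m ≠ n := by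
    rintro m _ h h' rfl
    exact h' h
  have hcard : ({i, j, k, l} : Finset (Fin d)).card = 4 := by
    simp [hij, hkl, hne hi hk, hne hi hl, hne hj hk, hne hj hl]
  simpa [hcard] using Finset.card_le_univ ({i, j, k, l} : Finset (Fin d))

theorem almostPencil_of_card {p : Fin 3 → ℂ} (hp : p ≠ 0) {s : Finset (Fin d)} (i : Fin d)
    (hs : d ≤ s.card + 2) (h : ∀ m ∈ s, A.coeff m ⬝ᵥ p = 0) : A.AlmostPencil := by
  by_contra hcon
  have third : ∀ a b, ∃ m, m ≠ a ∧ m ≠ b ∧ m ∈ sᶜ := by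
    intro a b
    by_contra! h'
    refine hcon ⟨p, hp, a, b, fun m ha hb => h m ?_⟩
    simpa using h' m ha hb
  obtain ⟨a, -, -, ha⟩ := third i i
  obtain ⟨b, hba, -, hb⟩ := third a a
  obtain ⟨c, hca, hcb, hc⟩ := third a b
  have := Finset.two_lt_card.2 ⟨a, ha, b, hb, c, hc, hba.symm, hca.symm, hcb.symm⟩
  rw [Finset.card_compl, Fintype.card_fin] at this
  omega

theorem mk_submodule_le_line {p : Fin 3 → ℂ} (hp : p ≠ 0) (i : Fin d) :
    (Projectivization.mk ℂ p hp).submodule ≤ A.line i ↔ A.coeff i ⬝ᵥ p = 0 := by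
  rw [Projectivization.submodule_mk, Submodule.span_singleton_le_iff_mem]
  rfl

theorem mult_mk {p : Fin 3 → ℂ} (hp : p ≠ 0) :
    A.mult (Projectivization.mk ℂ p hp) = {i | A.coeff i ⬝ᵥ p = 0}.ncard := by
  simp only [mult, mk_submodule_le_line]

/-- Two distinct lines have only one common point. -/
theorem mk_eq_mk_of_two_lines {i j : Fin d} (hij : i ≠ j) {p q : Fin 3 → ℂ} (hp : p ≠ 0)
    (hq : q ≠ 0) (hip : A.coeff i ⬝ᵥ p = 0) (hjp : A.coeff j ⬝ᵥ p = 0)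
    (hiq : A.coeff i ⬝ᵥ q = 0) (hjq : A.coeff j ⬝ᵥ q = 0) :
    Projectivization.mk ℂ p hp = Projectivization.mk ℂ q hq := by
  obtain ⟨v, hv⟩ := exists_not_concurrent (A.not_proportional i j hij) (A.coeff_ne_zero j)
  have hvq : v ⬝ᵥ q ≠ 0 := fun h => hv ⟨q, hq, hiq, h, hjq⟩
  rw [Projectivization.mk_eq_mk_iff']
  refine ⟨(v ⬝ᵥ p) / (v ⬝ᵥ q), eq_of_dotProduct hv ?_ ?_ ?_⟩
  · rw [dotProduct_smul, hiq, hip, smul_zero]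
  · rw [dotProduct_smul, smul_eq_mul, div_mul_cancel₀ _ hvq]
  · rw [dotProduct_smul, hjq, hjp, smul_zero]

/-- Exactly two lines `a`, `b` miss `p`. A point other than `p` and `r = a ∩ b` lies on at most one
line of the pencil and at most one of `a`, `b`. The two cases are whether a line of the pencil
passes through `r`; `A` itself is the model arrangement. -/
theorem AlmostPencil.stratum (hA : mdr A.poly = 2) (h : A.AlmostPencil) :
    A.InStratumL (d - 2) ∨ (5 ≤ d ∧ A.InStratumLhat 3 (d - 2)) := by
  obtain ⟨p, hp, a, b, hab', hap, hbp, through⟩ : ∃ p ≠ 0, ∃ a b, a ≠ b ∧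
      A.coeff a ⬝ᵥ p ≠ 0 ∧ A.coeff b ⬝ᵥ p ≠ 0 ∧
      ∀ m, m ≠ a → m ≠ b → A.coeff m ⬝ᵥ p = 0 := by
    obtain ⟨p, hp, a, b, h⟩ := h
    obtain ⟨i, j, hij, hi, hj⟩ := exists_two_off hA hp
    refine ⟨p, hp, i, j, hij, hi, hj, fun m hmi hmj => ?_⟩
    by_contra hm
    have mem : ∀ n, A.coeff n ⬝ᵥ p ≠ 0 → n = a ∨ n = b := by
      intro n hn
      by_contra! h'
      exact hn (h n h'.1 h'.2)
    rcases mem i hi with rfl | rfl <;> rcases mem j hj with rfl | rfl <;>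
      rcases mem m hm with rfl | rfl <;> contradiction
  have four := four_le_of_mdr_eq_two hA
  obtain ⟨r, hr, har, hbr⟩ := exists_common_zero (A.coeff a) (A.coeff b)
  have hpr : Projectivization.mk ℂ p hp ≠ Projectivization.mk ℂ r hr := by
    rw [Ne, Projectivization.mk_eq_mk_iff']
    rintro ⟨c, rfl⟩
    exact hap (by rw [dotProduct_smul, har, smul_zero])
  have hmult : A.mult (Projectivization.mk ℂ p hp) = d - 2 := by
    have : {i | A.coeff i ⬝ᵥ p = 0} = ({a, b} : Set (Fin d))ᶜ := by
      ext i
      simp only [Set.mem_ofPred_eq, Set.mem_compl_iff, Set.mem_insert_iff, Set.mem_singleton_iff,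
        not_or]
      constructor
      · exact fun h => ⟨fun e => hap (e ▸ h), fun e => hbp (e ▸ h)⟩
      · exact fun h => through i h.1 h.2
    rw [mult_mk, this, Set.ncard_compl, Set.ncard_pair hab', Nat.card_eq_fintype_card,
      Fintype.card_fin]
  have hother : ∀ q, q ≠ Projectivization.mk ℂ p hp → q ≠ Projectivization.mk ℂ r hr →
      A.mult q ≤ 2 := by
    intro q
    induction q using Projectivization.ind with | h q hq => ?_
    intro hqp hqr
    by_contra! hlt
    rw [mult_mk, Set.two_lt_ncard] at hlt
    obtain ⟨i, hi, j, hj, k, hk, hij, hik, hjk⟩ := hlt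
    have two : ∀ m n, m ≠ n → A.coeff m ⬝ᵥ q = 0 → A.coeff n ⬝ᵥ q = 0 →
        A.coeff m ⬝ᵥ p = 0 → A.coeff n ⬝ᵥ p = 0 → False :=
      fun m n hmn hmq hnq hmp hnp => hqp (mk_eq_mk_of_two_lines hmn hq hp hmq hnq hmp hnp)
    have hnot : A.coeff a ⬝ᵥ q = 0 → A.coeff b ⬝ᵥ q = 0 → False :=
      fun h1 h2 => hqr (mk_eq_mk_of_two_lines hab' hq hr h1 h2 har hbr)
    have dich : ∀ m, m = a ∨ m = b ∨ A.coeff m ⬝ᵥ p = 0 := by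
      intro m
      by_cases h1 : m = a
      · exact Or.inl h1
      by_cases h2 : m = b
      · exact Or.inr (Or.inl h2)
      exact Or.inr (Or.inr (through m h1 h2))
    simp only [Set.mem_ofPred_eq] at hi hj hk
    have t1 := two i j hij hi hj
    have t2 := two i k hik hi hk
    have t3 := two j k hjk hj hk
    rcases dich i with rfl | rfl | h1 <;> rcases dich j with rfl | rfl | h2 <;>
      rcases dich k with rfl | rfl | h3 <;>
    first
      | exact hij rfl
      | exact hik rfl
      | exact hjk rfl
      | exact hnot hi hj
      | exact hnot hj hi
      | exact hnot hi hk
      | exact hnot hk hi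
      | exact hnot hj hk
      | exact hnot hk hj
      | exact t1 h1 h2
      | exact t2 h1 h3
      | exact t3 h2 h3
  by_cases hm : ∃ m, m ≠ a ∧ m ≠ b ∧ A.coeff m ⬝ᵥ r = 0
  · right
    obtain ⟨m, hma, hmb, hmr⟩ := hm
    have uniq : ∀ n, A.coeff n ⬝ᵥ p = 0 → A.coeff n ⬝ᵥ r = 0 → n = m := by
      intro n hnp hnr
      by_contra hnm
      exact hpr (mk_eq_mk_of_two_lines hnm hp hr hnp (through m hma hmb) hnr hmr)
    have hset : {i | A.coeff i ⬝ᵥ r = 0} = {a, b, m} := by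
      ext n
      simp only [Set.mem_ofPred_eq, Set.mem_insert_iff, Set.mem_singleton_iff]
      constructor
      · intro hn
        by_cases hna : n = a
        · exact Or.inl hna
        by_cases hnb : n = b
        · exact Or.inr (Or.inl hnb)
        exact Or.inr (Or.inr (uniq n (through n hna hnb) hn))
      · rintro (rfl | rfl | rfl) <;> assumption
    have five : 5 ≤ d := by
      obtain ⟨k, l, hkl, hk, hl⟩ := exists_two_off hA hr
      have hne : ∀ {m n}, A.coeff m ⬝ᵥ r = 0 → A.coeff n ⬝ᵥ r ≠ 0 → m ≠ n := by
        rintro m _ h h' rfl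
        exact h' h
      have hcard : ({a, b, m, k, l} : Finset (Fin d)).card = 5 := by
        simp [hab', hkl, hma.symm, hmb.symm, hne har hk, hne har hl, hne hbr hk, hne hbr hl,
          hne hmr hk, hne hmr hl]
      simpa [hcard] using Finset.card_le_univ ({a, b, m, k, l} : Finset (Fin d))
    refine ⟨five, A, ⟨le_rfl, by omega, by omega, _, _, hpr.symm, ?_, hmult, ?_, ?_⟩,
      ⟨OrderIso.refl _⟩⟩
    · rw [mult_mk, hset, Set.ncard_eq_three]
      exact ⟨a, b, m, hab', hma.symm, hmb.symm, rfl⟩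
    · simp only [mk_submodule_le_line]
      exact ⟨m, ⟨hmr, through m hma hmb⟩, fun n hn => uniq n hn.2 hn.1⟩
    · exact fun q h1 h2 => hother q h2 h1
  · left
    push Not at hm
    refine ⟨A, ⟨_, hmult, fun q hq => ?_⟩, ⟨OrderIso.refl _⟩⟩
    by_cases hqr : q = Projectivization.mk ℂ r hr
    · rw [hqr, mult_mk, ← Set.ncard_pair hab']
      refine Set.ncard_le_ncard (fun n hn => ?_) (Set.toFinite _)
      by_contra hn'
      simp only [Set.mem_insert_iff, Set.mem_singleton_iff, not_or] at hn'
      exact hm n hn'.1 hn'.2 hn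
    · exact hother q hq hqr

/-! ### The braid configuration -/

/-- The lines with indices `i`, `j`, `k` are concurrent. -/
def Triple (A : LineArrangement d) (i j k : Fin d) : Prop :=
  Concurrent (A.coeff i) (A.coeff j) (A.coeff k)

theorem Triple.rotate {i j k : Fin d} (h : A.Triple i j k) : A.Triple j k i := by
  obtain ⟨p, hp, h1, h2, h3⟩ := h
  exact ⟨p, hp, h2, h3, h1⟩

theorem Triple.swap {i j k : Fin d} (h : A.Triple i j k) : A.Triple j i k := by
  obtain ⟨p, hp, h1, h2, h3⟩ := h
  exact ⟨p, hp, h2, h1, h3⟩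

/-- The incidence properties of an arrangement that is not an almost pencil but has an invariant
quadratic vector field. -/
structure Sparse (A : LineArrangement d) : Prop where
  triple_unique : ∀ {i j k l}, i ≠ j → i ≠ k → i ≠ l → j ≠ k → j ≠ l → k ≠ l →
    A.Triple i j k → A.Triple i j l → False
  exists_triple : ∀ {o i j k l}, i ≠ o → j ≠ o → k ≠ o → l ≠ o →
    i ≠ j → i ≠ k → i ≠ l → j ≠ k → j ≠ l → k ≠ l →
    A.Triple o i j ∨ A.Triple o i k ∨ A.Triple o i l ∨ A.Triple o j k ∨ A.Triple o j l ∨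
      A.Triple o k l

theorem sparse_of_not_almostPencil (hA : mdr A.poly = 2) (h : ¬ A.AlmostPencil) : A.Sparse := by
  obtain ⟨F⟩ := exists_invariantField hA
  constructor
  · rintro i j k l hij hik hil hjk hjl hkl ⟨p, hp, h1, h2, h3⟩ h'
    exact h (F.almostPencil_of_four_concurrent hp hij hik hil hjk hjl hkl h1 h2 h3
      (dotProduct_eq_zero_of_concurrent hij h' h1 h2))
  · intro o i j k l hi hj hk hl hij hik hil hjk hjl hkl
    by_contra! hn
    obtain ⟨h1, h2, h3, h4, h5, h6⟩ := hn
    exact h (F.almostPencil_of_four_points hA hi hj hk hl hkl hik hjk hil hjl h1 h2 h3 h4 h5 h6)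

/-- Five lines of which two pairs meet the first one in two triple points. -/
structure TwoTriples (A : LineArrangement d) (o a b c e : Fin d) : Prop where
  oa : o ≠ a
  ob : o ≠ b
  oc : o ≠ c
  oe : o ≠ e
  ab : a ≠ b
  ac : a ≠ c
  ae : a ≠ e
  bc : b ≠ c
  be : b ≠ e
  ce : c ≠ e
  oab : A.Triple o a b
  oce : A.Triple o c e

theorem TwoTriples.swap_left {o a b c e : Fin d} (h : A.TwoTriples o a b c e) :
    A.TwoTriples o b a c e :=
  ⟨h.ob, h.oa, h.oc, h.oe, h.ab.symm, h.bc, h.be, h.ac, h.ae, h.ce, h.oab.swap.rotate, h.oce⟩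

theorem TwoTriples.swap_right {o a b c e : Fin d} (h : A.TwoTriples o a b c e) :
    A.TwoTriples o a b e c :=
  ⟨h.oa, h.ob, h.oe, h.oc, h.ab, h.ae, h.ac, h.be, h.bc, h.ce.symm, h.oab, h.oce.swap.rotate⟩

/-! ### Combinatorics of triple points -/

namespace Sparse

/-- Any five lines contain a triple, say `o, a, b`. Among `a` and three further lines some pair is
concurrent with `o`, and that pair cannot involve `a`. -/
theorem exists_twoTriples (hS : A.Sparse) (hd : 6 ≤ d) : ∃ o a b c e, A.TwoTriples o a b c e := by
  obtain ⟨o, a, b, hoa, hob, hab, hoab⟩ :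
      ∃ o a b, o ≠ a ∧ o ≠ b ∧ a ≠ b ∧ A.Triple o a b := by
    have h0 : 0 < d := by omega
    have h1 : 1 < d := by omega
    have h2 : 2 < d := by omega
    have h3 : 3 < d := by omega
    have h4 : 4 < d := by omega
    rcases hS.exists_triple (o := ⟨0, h0⟩) (i := ⟨1, h1⟩) (j := ⟨2, h2⟩) (k := ⟨3, h3⟩)
      (l := ⟨4, h4⟩) (by simp) (by simp) (by simp) (by simp) (by simp) (by simp) (by simp)
      (by simp) (by simp) (by simp) with h | h | h | h | h | h <;>
    exact ⟨_, _, _, by simp, by simp, by simp, h⟩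
  obtain ⟨x, hx, y, hy, z, hz, hxy, hxz, hyz⟩ :
      ∃ x ∈ ({o, a, b} : Finset (Fin d))ᶜ, ∃ y ∈ ({o, a, b} : Finset (Fin d))ᶜ,
        ∃ z ∈ ({o, a, b} : Finset (Fin d))ᶜ, x ≠ y ∧ x ≠ z ∧ y ≠ z := by
    rw [← Finset.two_lt_card, Finset.card_compl, Fintype.card_fin]
    have := Finset.card_le_three (a := o) (b := a) (c := b)
    omega
  simp only [Finset.mem_compl, Finset.mem_insert, Finset.mem_singleton, not_or] at hx hy hz
  have no : ∀ n, n ≠ o → n ≠ a → n ≠ b → A.Triple o a n → False := fun n h1 h2 h3 h =>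
    hS.triple_unique hoa hob h1.symm hab h2.symm h3.symm hoab h
  rcases hS.exists_triple (o := o) (i := a) (j := x) (k := y) (l := z) hoa.symm hx.1 hy.1 hz.1
    (Ne.symm hx.2.1) (Ne.symm hy.2.1) (Ne.symm hz.2.1) hxy hxz hyz with h | h | h | h | h | h
  · exact (no x hx.1 hx.2.1 hx.2.2 h).elim
  · exact (no y hy.1 hy.2.1 hy.2.2 h).elim
  · exact (no z hz.1 hz.2.1 hz.2.2 h).elim
  · exact ⟨o, a, b, x, y, hoa, hob, Ne.symm hx.1, Ne.symm hy.1, hab, Ne.symm hx.2.1,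
      Ne.symm hy.2.1, Ne.symm hx.2.2, Ne.symm hy.2.2, hxy, hoab, h⟩
  · exact ⟨o, a, b, x, z, hoa, hob, Ne.symm hx.1, Ne.symm hz.1, hab, Ne.symm hx.2.1,
      Ne.symm hz.2.1, Ne.symm hx.2.2, Ne.symm hz.2.2, hxz, hoab, h⟩
  · exact ⟨o, a, b, y, z, hoa, hob, Ne.symm hy.1, Ne.symm hz.1, hab, Ne.symm hy.2.1,
      Ne.symm hz.2.1, Ne.symm hy.2.2, Ne.symm hz.2.2, hyz, hoab, h⟩

theorem side (hS : A.Sparse) {o a b c e r : Fin d} (h : A.TwoTriples o a b c e) (hro : r ≠ o)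
    (hra : r ≠ a) (hrb : r ≠ b) (hrc : r ≠ c) (hre : r ≠ e) :
    A.Triple a c r ∨ A.Triple a e r := by
  have no : ∀ n, n ≠ o → n ≠ a → n ≠ b → A.Triple a o n → False := fun n h1 h2 h3 h' =>
    hS.triple_unique h.oa h.ob h1.symm h.ab h2.symm h3.symm h.oab h'.swap
  rcases hS.exists_triple (o := a) (i := o) (j := c) (k := e) (l := r) h.oa h.ac.symm h.ae.symm
    hra h.oc h.oe hro.symm h.ce hrc.symm hre.symm with h' | h' | h' | h' | h' | h'
  · exact (no c h.oc.symm h.ac.symm h.bc.symm h').elim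
  · exact (no e h.oe.symm h.ae.symm h.be.symm h').elim
  · exact (no r hro hra hrb h').elim
  · exact (hS.triple_unique h.ce h.oc.symm h.ac.symm h.oe.symm h.ae.symm h.oa
      h.oce.rotate h'.rotate).elim
  · exact Or.inl h'
  · exact Or.inr h'

/-- The lines `a, b, c, e` form a complete quadrilateral with diagonal `o` joining `a ∩ b` to `c ∩
e`. Any sixth line is one of the other two diagonals. -/
theorem diagonal (hS : A.Sparse) {o a b c e r : Fin d} (h : A.TwoTriples o a b c e) (hro : r ≠ o)
    (hra : r ≠ a) (hrb : r ≠ b) (hrc : r ≠ c) (hre : r ≠ e) :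
    (A.Triple a c r ∧ A.Triple b e r) ∨ (A.Triple a e r ∧ A.Triple b c r) := by
  have h1 := hS.side h hro hra hrb hrc hre
  have h2 := hS.side h.swap_left hro hrb hra hrc hre
  have h3 : A.Triple a c r → A.Triple b c r → False := fun t t' =>
    hS.triple_unique hrc.symm h.ac.symm h.bc.symm hra hrb h.ab t.rotate t'.rotate
  have h4 : A.Triple a e r → A.Triple b e r → False := fun t t' =>
    hS.triple_unique hre.symm h.ae.symm h.be.symm hra hrb h.ab t.rotate t'.rotate
  tauto

end Sparse

/-- The six lines joining four points in general position. -/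
theorem TwoTriples.normalForm {o a b c e r : Fin d} (h : A.TwoTriples o a b c e)
    (hnc : ¬ A.Triple a b c) (hac : A.Triple a c r) (hbe : A.Triple b e r) :
    ∃ u v w : Fin 3 → ℂ, ¬ Concurrent u v w ∧ ∃ s₁ s₂ s₃ s₄ s₅ : ℂ,
      A.coeff a = s₁ • u ∧ A.coeff b = s₂ • v ∧ A.coeff c = s₃ • w ∧
      A.coeff e = s₄ • (w - u + v) ∧ A.coeff o = u - v ∧ A.coeff r = s₅ • (w - u) := by
  obtain ⟨α, β, ho⟩ := eq_combination h.ab h.oab.rotate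
  obtain ⟨γ, δ, ho'⟩ := eq_combination h.ce h.oce.rotate
  have hα : α ≠ 0 := by
    rintro rfl
    exact A.not_proportional o b h.ob β (by rw [ho]; module)
  have hβ : β ≠ 0 := by
    rintro rfl
    exact A.not_proportional o a h.oa α (by rw [ho]; module)
  have hγ : γ ≠ 0 := by
    rintro rfl
    exact A.not_proportional o e h.oe δ (by rw [ho']; module)
  have hδ : δ ≠ 0 := by
    rintro rfl
    exact A.not_proportional o c h.oc γ (by rw [ho']; module)
  have ha : A.coeff a = α⁻¹ • (α • A.coeff a) := by rw [smul_smul, inv_mul_cancel₀ hα, one_smul]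
  have hb : A.coeff b = (-β)⁻¹ • (-β • A.coeff b) := by
    rw [smul_smul, inv_mul_cancel₀ (neg_ne_zero.2 hβ), one_smul]
  have hc : A.coeff c = γ⁻¹ • (γ • A.coeff c) := by rw [smul_smul, inv_mul_cancel₀ hγ, one_smul]
  -- Equating the two expressions of `ℓ_o` gives `α ℓ_a + β ℓ_b = γ ℓ_c + δ ℓ_e`; the choice `u = α
  -- ℓ_a`, `v = -β ℓ_b`, `w = γ ℓ_c` absorbs the scalars.
  have he : A.coeff e = (-δ)⁻¹ • (γ • A.coeff c - α • A.coeff a + -β • A.coeff b) := by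
    have : γ • A.coeff c - α • A.coeff a + -β • A.coeff b = -δ • A.coeff e := by
      have := ho.symm.trans ho'
      rw [← sub_eq_zero] at this ⊢
      rw [← neg_eq_zero, ← this]
      module
    rw [this, smul_smul, inv_mul_cancel₀ (neg_ne_zero.2 hδ), one_smul]
  have hind : ¬ Concurrent (α • A.coeff a) (-β • A.coeff b) (γ • A.coeff c) := by
    rintro ⟨p, hp, h1, h2, h3⟩
    rw [smul_dotProduct, smul_eq_mul] at h1 h2 h3
    exact hnc ⟨p, hp, (mul_eq_zero.1 h1).resolve_left hα,
      (mul_eq_zero.1 h2).resolve_left (neg_ne_zero.2 hβ), (mul_eq_zero.1 h3).resolve_left hγ⟩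
  have ho₁ : A.coeff o = α • A.coeff a - -β • A.coeff b := by rw [ho]; module
  generalize α • A.coeff a = u at *
  generalize -β • A.coeff b = v at *
  generalize γ • A.coeff c = w at *
  obtain ⟨s, t, hr⟩ := eq_combination h.ac hac
  obtain ⟨s', t', hr'⟩ := eq_combination h.be hbe
  obtain ⟨x, x1, x2, x3⟩ := exists_dual hind 1 0 0
  obtain ⟨y, y1, y2, y3⟩ := exists_dual hind 0 0 1
  refine ⟨u, v, w, hind, α⁻¹, (-β)⁻¹, γ⁻¹, (-δ)⁻¹, t * γ⁻¹, ha, hb, hc, he, ho₁, ?_⟩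
  -- `ℓ_r` lies in the span of `u, w` and in that of `v, w - u + v`, which forces a multiple of `w -
  -- u`.
  rw [hb, he] at hr'
  rw [ha, hc] at hr
  have key := hr.symm.trans hr'
  have kx := congrArg (· ⬝ᵥ x) key
  have ky := congrArg (· ⬝ᵥ y) key
  simp only [add_dotProduct, sub_dotProduct, smul_dotProduct, smul_eq_mul, x1, x2, x3, y1, y2,
    y3] at kx ky
  have hs : s * α⁻¹ = -(t * γ⁻¹) := by linear_combination kx + ky
  rw [hr, smul_smul, smul_smul, hs]
  module

/-- Fano's axiom: in the normal form the diagonals are `u - v`, `w - u` and `v + w`, which are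
independent because 2 is invertible. -/
theorem TwoTriples.not_both_diagonals {o a b c e r r' : Fin d} (h : A.TwoTriples o a b c e)
    (hnc : ¬ A.Triple a b c) (hac : A.Triple a c r) (hbe : A.Triple b e r)
    (hae : A.Triple a e r') (hbc : A.Triple b c r') : ¬ A.Triple o r r' := by
  obtain ⟨u, v, w, hind, s₁, s₂, s₃, s₄, s₅, ha, hb, hc, he, ho, hr⟩ := h.normalForm hnc hac hbe
  have hs₅ : s₅ ≠ 0 := by
    rintro rfl
    exact A.coeff_ne_zero r (by rw [hr, zero_smul])
  obtain ⟨s, t, hr'⟩ := eq_combination h.ae hae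
  obtain ⟨s', t', hr''⟩ := eq_combination h.bc hbc
  rw [ha, he] at hr'
  rw [hb, hc] at hr''
  obtain ⟨x, x1, x2, x3⟩ := exists_dual hind 1 0 0
  have kx := congrArg (· ⬝ᵥ x) (hr'.symm.trans hr'')
  simp only [add_dotProduct, sub_dotProduct, smul_dotProduct, smul_eq_mul, x1, x2, x3] at kx
  have hs : s * s₁ = t * s₄ := by linear_combination kx
  have hr₂ : A.coeff r' = (t * s₄) • (v + w) := by
    rw [hr', smul_smul, smul_smul, hs]
    module
  have ht : t * s₄ ≠ 0 := by
    intro h0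
    exact A.coeff_ne_zero r' (by rw [hr₂, h0, zero_smul])
  rintro ⟨p, hp, h1, h2, h3⟩
  rw [ho, sub_dotProduct] at h1
  rw [hr, smul_dotProduct, smul_eq_mul] at h2
  rw [hr₂, smul_dotProduct, smul_eq_mul] at h3
  have h2' := (mul_eq_zero.1 h2).resolve_left hs₅
  have h3' := (mul_eq_zero.1 h3).resolve_left ht
  rw [sub_dotProduct] at h2'
  rw [add_dotProduct] at h3'
  exact hind ⟨p, hp, by linear_combination (h1 - h2' + h3') / 2,
    by linear_combination (-h1 - h2' + h3') / 2, by linear_combination (h1 + h2' + h3') / 2⟩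

/-- A sparse arrangement of at least six lines consists of the six lines joining four points in
general position. -/
theorem Sparse.exists_braid (hS : A.Sparse) (hd : 6 ≤ d) : ∃ o a b c e r,
    A.TwoTriples o a b c e ∧ ¬ A.Triple a b c ∧ A.Triple a c r ∧ A.Triple b e r ∧
    r ∉ ({o, a, b, c, e} : Finset (Fin d)) ∧
    (Finset.univ : Finset (Fin d)) = {r, o, a, b, c, e} := by
  obtain ⟨o, a, b, c, e, r, h, hr, hac, hbe⟩ : ∃ o a b c e r, A.TwoTriples o a b c e ∧
      r ∉ ({o, a, b, c, e} : Finset (Fin d)) ∧ A.Triple a c r ∧ A.Triple b e r := by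
    obtain ⟨o, a, b, c, e, h⟩ := hS.exists_twoTriples hd
    obtain ⟨r, hr⟩ : ∃ r, r ∉ ({o, a, b, c, e} : Finset (Fin d)) := by
      by_contra! hall
      have h1 := Finset.card_le_five (a := o) (b := a) (c := b) (d := c) (e := e)
      rw [Finset.eq_univ_iff_forall.2 hall, Finset.card_univ, Fintype.card_fin] at h1
      omega
    have hr' := hr
    simp only [Finset.mem_insert, Finset.mem_singleton, not_or] at hr'
    obtain ⟨h1, h2, h3, h4, h5⟩ := hr'
    rcases hS.diagonal h h1 h2 h3 h4 h5 with ⟨t, t'⟩ | ⟨t, t'⟩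
    · exact ⟨o, a, b, c, e, r, h, hr, t, t'⟩
    · refine ⟨o, a, b, e, c, r, h.swap_right, ?_, t, t'⟩
      simp [h1, h2, h3, h4, h5]
  have hnc : ¬ A.Triple a b c := fun t =>
    hS.triple_unique h.ab h.oa.symm h.ac h.ob.symm h.bc h.oc h.oab.rotate t
  refine ⟨o, a, b, c, e, r, h, hnc, hac, hbe, hr, ?_⟩
  symm
  rw [Finset.eq_univ_iff_forall]
  intro r'
  by_contra hr'
  simp only [Finset.mem_insert, Finset.mem_singleton, not_or] at hr hr'
  obtain ⟨h1, h2, h3, h4, h5⟩ := hr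
  obtain ⟨h0', h1', h2', h3', h4', h5'⟩ := hr'
  rcases hS.diagonal h h1' h2' h3' h4' h5' with ⟨t, t'⟩ | ⟨t, t'⟩
  -- A second line on the same diagonal would share the pair `a, c` with `r`.
  · exact hS.triple_unique h.ac (Ne.symm h2) (Ne.symm h2') (Ne.symm h4) (Ne.symm h4')
      (Ne.symm h0') hac t
  · have noa : ∀ n, n ≠ o → n ≠ a → n ≠ b → A.Triple o a n → False := fun n g1 g2 g3 g =>
      hS.triple_unique h.oa h.ob g1.symm h.ab g2.symm g3.symm h.oab g
    have noc : ∀ n, n ≠ o → n ≠ c → n ≠ e → A.Triple o c n → False := fun n g1 g2 g3 g =>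
      hS.triple_unique h.oc h.oe g1.symm h.ce g2.symm g3.symm h.oce g
    -- If `r` and `r'` are different diagonals, sparseness at `o` leaves only the triple `o, r, r'`,
    -- which Fano's axiom excludes.
    rcases hS.exists_triple (o := o) (i := a) (j := c) (k := r) (l := r') h.oa.symm h.oc.symm
      h1 h1' h.ac (Ne.symm h2) (Ne.symm h2') (Ne.symm h4) (Ne.symm h4') (Ne.symm h0')
      with g | g | g | g | g | g
    · exact noa c h.oc.symm h.ac.symm h.bc.symm g
    · exact noa r h1 h2 h3 g
    · exact noa r' h1' h2' h3' g
    · exact noc r h1 h4 h5 g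
    · exact noc r' h1' h4' h5' g
    · exact h.not_both_diagonals hnc hac hbe t t' g

/-! ### Normal form of the braid arrangement -/

theorem aeval_linForm (g : Matrix (Fin 3) (Fin 3) ℂ) (u : Fin 3 → ℂ) :
    aeval (fun i => linForm (fun j => g i j)) (linForm u) = linForm (Matrix.vecMul u g) := by
  apply MvPolynomial.funext
  intro x
  simp only [linForm, map_add, map_mul, aeval_X, algHom_C, algebraMap_eq, eval_C, eval_X,
    Matrix.vecMul, dotProduct, Fin.sum_univ_three]
  ring

/-- The images are `x - y`, `x - z`, `x + z`, so that `w - u`, `u - v` and `w - u + v` become `y +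
z`, `z - y` and `x + y`. -/
theorem exists_change_of_coordinates {u v w : Fin 3 → ℂ} (h : ¬ Concurrent u v w) :
    ∃ g : GL (Fin 3) ℂ, Matrix.vecMul u g = ![1, -1, 0] ∧ Matrix.vecMul v g = ![1, 0, -1] ∧
      Matrix.vecMul w g = ![1, 0, 1] := by
  rw [concurrent_iff_det] at h
  set N := Matrix.of ![u, v, w] with hN
  set T : Matrix (Fin 3) (Fin 3) ℂ := Matrix.of ![![1, -1, 0], ![1, 0, -1], ![1, 0, 1]] with hT
  have hT' : T.det ≠ 0 := by
    simp [hT, Matrix.det_fin_three]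
  have hdet : (N⁻¹ * T).det ≠ 0 := by
    rw [Matrix.det_mul, Matrix.det_nonsing_inv, Ring.inverse_eq_inv']
    exact mul_ne_zero (inv_ne_zero h) hT'
  have key : N * (N⁻¹ * T) = T := by
    rw [← Matrix.mul_assoc, Matrix.mul_nonsing_inv _ (isUnit_iff_ne_zero.2 h), Matrix.one_mul]
  refine ⟨Matrix.GeneralLinearGroup.mkOfDetNeZero _ hdet, ?_, ?_, ?_⟩
  · exact (Matrix.mul_apply_eq_vecMul N (N⁻¹ * T) 0).symm.trans (congrFun key 0)
  · exact (Matrix.mul_apply_eq_vecMul N (N⁻¹ * T) 1).symm.trans (congrFun key 1)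
  · exact (Matrix.mul_apply_eq_vecMul N (N⁻¹ * T) 2).symm.trans (congrFun key 2)

theorem Sparse.linearlyEquivalent (hS : A.Sparse) (hd : 6 ≤ d) :
    LinearlyEquivalent A.poly (monomialPoly 2) := by
  obtain ⟨o, a, b, c, e, r, h, hnc, hac, hbe, hr, huniv⟩ := hS.exists_braid hd
  obtain ⟨u, v, w, hind, s₁, s₂, s₃, s₄, s₅, ha, hb, hc, he, ho, hr'⟩ := h.normalForm hnc hac hbe
  obtain ⟨g, hu, hv, hw⟩ := exists_change_of_coordinates hind
  have hne : ∀ {i} {s : ℂ} {z : Fin 3 → ℂ}, A.coeff i = s • z → s ≠ 0 := by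
    rintro i _ z hi rfl
    exact A.coeff_ne_zero i (by rw [hi, zero_smul])
  -- The sign comes from `u - v` going to `z - y` rather than `y - z`.
  refine ⟨g, -(s₁ * s₂ * s₃ * s₄ * s₅), neg_ne_zero.2 (mul_ne_zero (mul_ne_zero (mul_ne_zero
    (mul_ne_zero (hne ha) (hne hb)) (hne hc)) (hne he)) (hne hr')), ?_⟩
  have image : ∀ {i : Fin d} {z : Fin 3 → ℂ}, Matrix.vecMul (A.coeff i) g = z →
      aeval (fun i => linForm (fun j => (g : Matrix (Fin 3) (Fin 3) ℂ) i j))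
        (linForm (A.coeff i)) = linForm z := fun hz => by rw [aeval_linForm, hz]
  rw [poly, map_prod, huniv, Finset.prod_insert hr,
    Finset.prod_insert (by simp [h.oa, h.ob, h.oc, h.oe]),
    Finset.prod_insert (by simp [h.ab, h.ac, h.ae]), Finset.prod_insert (by simp [h.bc, h.be]),
    Finset.prod_insert (by simp [h.ce]), Finset.prod_singleton,
    image (i := r) (z := s₅ • ![0, 1, 1]) (by
      rw [hr', Matrix.smul_vecMul, Matrix.sub_vecMul, hu, hw]; simp),
    image (i := o) (z := ![0, -1, 1]) (by rw [ho, Matrix.sub_vecMul, hu, hv]; simp),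
    image (i := a) (z := s₁ • ![1, -1, 0]) (by rw [ha, Matrix.smul_vecMul, hu]),
    image (i := b) (z := s₂ • ![1, 0, -1]) (by rw [hb, Matrix.smul_vecMul, hv]),
    image (i := c) (z := s₃ • ![1, 0, 1]) (by rw [hc, Matrix.smul_vecMul, hw]),
    image (i := e) (z := s₄ • ![1, 1, 0]) (by
      rw [he, Matrix.smul_vecMul, Matrix.add_vecMul, Matrix.sub_vecMul, hu, hv, hw]; simp)]
  simp only [linForm_smul, monomialPoly]
  simp only [linForm, Fin.sum_univ_three, Matrix.cons_val, map_neg, map_mul, map_one, map_zero]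
  ring

/-- With four lines, the intersection of any two is a centre. With five, any triple point is one,
and sparseness would provide a triple point. -/
theorem almostPencil_of_le_five (hA : mdr A.poly = 2) (hd : d ≤ 5) : A.AlmostPencil := by
  have four := four_le_of_mdr_eq_two hA
  have h0 : 0 < d := by omega
  have h1 : 1 < d := by omega
  rcases hd.lt_or_eq with hlt | rfl
  · obtain ⟨p, hp, hi, hj⟩ := exists_common_zero (A.coeff ⟨0, h0⟩) (A.coeff ⟨1, h1⟩)
    refine almostPencil_of_card hp (s := {⟨0, h0⟩, ⟨1, h1⟩}) ⟨0, h0⟩ ?_ ?_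
    · rw [Finset.card_pair (by simp)]
      omega
    · simp [hi, hj]
  · by_contra h
    have hS := sparse_of_not_almostPencil hA h
    have triple : ∀ i j k, i ≠ j → i ≠ k → j ≠ k → A.Triple i j k → False := by
      rintro i j k hij hik hjk ⟨p, hp, hi, hj, hk⟩
      refine h (almostPencil_of_card hp (s := {i, j, k}) i ?_ ?_)
      · rw [Finset.card_eq_three.2 ⟨i, j, k, hij, hik, hjk, rfl⟩]
      · simp [hi, hj, hk]
    rcases hS.exists_triple (o := 0) (i := 1) (j := 2) (k := 3) (l := 4) (by simp) (by simp)
      (by simp) (by simp) (by simp) (by simp) (by simp) (by simp) (by simp) (by simp)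
      with h | h | h | h | h | h <;>
    exact triple _ _ _ (by simp) (by simp) (by simp) h

end LineArrangement

theorem theorem4p9 {d : ℕ} (A : LineArrangement d) (hA : mdr A.poly = 2) :
    4 ≤ d ∧
      (A.InStratumL (d - 2) ∨
        (5 ≤ d ∧ A.InStratumLhat 3 (d - 2)) ∨
        LinearlyEquivalent A.poly (monomialPoly 2)) := by
  refine ⟨LineArrangement.four_le_of_mdr_eq_two hA, ?_⟩
  by_cases h : A.AlmostPencil
  · rcases h.stratum hA with h | h
    · exact Or.inl h
    · exact Or.inr (Or.inl h)
  · refine Or.inr (Or.inr ?_)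
    refine (LineArrangement.sparse_of_not_almostPencil hA h).linearlyEquivalent ?_
    by_contra hd
    exact h (LineArrangement.almostPencil_of_le_five hA (by omega))
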